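/- Let $A$ be a real $n\times n$ matrix that is irreducible (no simultaneous permutation of rows and columns brings it to the form $\begin{bmatrix}A_{11}&A_{12}\\0&A_{22}\end{bmatrix}$ with nonempty square diagonal blocks) and has spectral radius $\rho(A)=1$. For $k\ge 2$, $A$ is called $k$-cyclic if $\{1,\dots,n\}$ has an ordered partition $(\pi_1,\dots,\pi_k)$ into nonempty sets such that $a_{ij}\neq 0$ implies $i\in\pi_\ell$ and $j\in\pi_{\ell+1}$ for some $\ell$ (with $\pi_{k+1}:=\pi_1$). Suppose that $A$ has index of cyclicity $h>1$, that is, $h$ is the largest $k$ for which $A$ is $k$-cyclic. Put $\omega=\exp(2\pi \mathrm{i}/h)$ and $J(\nu_h,1)=\operatorname{diag}(1,\omega,\dots,\omega^{h-1})$. Call $A$ eventually nonnegative if there is a $p$ such that $A^k$ is entrywise nonnegative for all $k\ge p$. Consider the condition (C) there are a nonsingular complex matrix $Z$ and a (possibly empty) direct sum $\hat J$ of Jordan blocks with $\rho(\hat J)<1$ such that $$Z^{-1}AZ=\begin{bmatrix}J(\nu_h,1)&0\\0&\hat J\end{bmatrix},$$ and there are entrywise positive real vectors $x,y$ with $x^\top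 A=x^\top$ and $Ay=y$ (left and right eigenvectors for the eigenvalue $\rho(A)=1$). If $\operatorname{rank}(A^2)=\operatorname{rank}(A)$ (in particular, if $A$ is nonsingular), then $A$ is eventually nonnegative if and only if (C) holds. The implication from (C) to eventual nonnegativity holds also without the rank condition. -/

import Mathlib

open scoped Matrix

namespace EvNonneg

/-- `A` is reducible: simultaneously permuting rows and columns (by `σ`) gives
`[A₁₁ A₁₂; 0 A₂₂]` with nonempty square diagonal blocks, `A₁₁` being of size `k`. -/
def IsReducible {n : ℕ} (A : Matrix (Fin n) (Fin n) ℝ) : Prop :=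
  ∃ (σ : Equiv.Perm (Fin n)) (k : ℕ), 0 < k ∧ k < n ∧
    ∀ i j : Fin n, k ≤ (i : ℕ) → (j : ℕ) < k → A (σ i) (σ j) = 0

/-- A matrix that is not reducible. (So every `1 × 1` matrix is irreducible.) -/
def IsIrreducible {n : ℕ} (A : Matrix (Fin n) (Fin n) ℝ) : Prop :=
  ¬ IsReducible A

/-- The ordered partition `π_ℓ = c ⁻¹' {ℓ}`, `ℓ ∈ ℤ/h`, into nonempty sets describes an
`h`-cyclic structure of `A`: every arc of the digraph of `A` goes from some `π_ℓ` to `π_{ℓ+1}`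
(indices modulo `h`). -/
def DescribesCyclic {n : ℕ} (A : Matrix (Fin n) (Fin n) ℝ) (h : ℕ) (c : Fin n → ZMod h) : Prop :=
  Function.Surjective c ∧ ∀ i j, A i j ≠ 0 → c j = c i + 1

/-- `A` is `h`-cyclic (`h ≥ 2`): its digraph is cyclically `h`-partite. -/
def IsCyclic {n : ℕ} (A : Matrix (Fin n) (Fin n) ℝ) (h : ℕ) : Prop :=
  2 ≤ h ∧ ∃ c : Fin n → ZMod h, DescribesCyclic A h c

/-- `h` is the index of cyclicity of `A`: the largest `h` for which `A` is `h`-cyclic. -/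
def HasCyclicIndex {n : ℕ} (A : Matrix (Fin n) (Fin n) ℝ) (h : ℕ) : Prop :=
  IsGreatest {k | IsCyclic A k} h

/-- All sufficiently large powers of `A` are entrywise nonnegative. -/
def EventuallyNonneg {n : ℕ} (A : Matrix (Fin n) (Fin n) ℝ) : Prop :=
  ∃ p : ℕ, ∀ k : ℕ, p ≤ k → ∀ i j, 0 ≤ (A ^ k) i j

/-- A real matrix regarded as a complex matrix. -/
def toComplex {n : ℕ} (A : Matrix (Fin n) (Fin n) ℝ) : Matrix (Fin n) (Fin n) ℂ :=
  A.map (fun a => (a : ℂ))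

/-- The upper triangular Jordan block `J_r(μ)`. -/
def jordanBlock (r : ℕ) (μ : ℂ) : Matrix (Fin r) (Fin r) ℂ :=
  Matrix.of fun i j => if i = j then μ else if (i : ℕ) + 1 = (j : ℕ) then 1 else 0

/-- The Jordan matrix `J_{r 0}(μ 0) ⊕ ⋯ ⊕ J_{r (t-1)}(μ (t-1))`. -/
def jordanMatrix {t : ℕ} (r : Fin t → ℕ) (μ : Fin t → ℂ) :
    Matrix (Σ s : Fin t, Fin (r s)) (Σ s : Fin t, Fin (r s)) ℂ :=
  Matrix.blockDiagonal' fun s => jordanBlock (r s) (μ s)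

/-- `J(ν_h, 1) = diag(1, ω, …, ω^(h-1))` with `ω = exp(2πi/h)`. -/
noncomputable def cyclicDiagonal (h : ℕ) : Matrix (Fin h) (Fin h) ℂ :=
  Matrix.diagonal fun k => Complex.exp (2 * Real.pi * Complex.I / h) ^ (k : ℕ)

/-- There is a nonsingular complex `Z` with `Z⁻¹ A Z = J(ν_h, 1) ⊕ Ĵ`, where `Ĵ` (possibly
empty) is a direct sum of Jordan blocks with spectral radius less than one. The bijection `e`
only numbers the rows and columns of the direct sum. -/
def HasCyclicJordanForm {n : ℕ} (A : Matrix (Fin n) (Fin n) ℝ) (h : ℕ) : Prop :=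
  ∃ (t : ℕ) (r : Fin t → ℕ) (μ : Fin t → ℂ) (e : Fin n ≃ Fin h ⊕ (Σ s : Fin t, Fin (r s)))
    (Z : Matrix (Fin n) (Fin n) ℂ),
    (∀ s, 0 < r s) ∧ IsUnit Z ∧
    Z⁻¹ * toComplex A * Z =
      (Matrix.fromBlocks (cyclicDiagonal h) 0 0 (jordanMatrix r μ)).submatrix e e ∧
    spectralRadius ℂ (jordanMatrix r μ) < 1

/-- `A` has an entrywise positive left eigenvector and an entrywise positive right eigenvector
for the eigenvalue `1`. -/
def HasPositiveEigenvectors {n : ℕ} (A : Matrix (Fin n) (Fin n) ℝ) : Prop :=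
  (∃ x : Fin n → ℝ, (∀ i, 0 < x i) ∧ x ᵥ* A = x) ∧
    (∃ y : Fin n → ℝ, (∀ i, 0 < y i) ∧ A *ᵥ y = y)

end EvNonneg

/-! From (C) to eventual nonnegativity: since `cyclicDiagonal h ^ h = 1` and the powers of `Ĵ` tend
to zero, `A ^ (h * q)` converges to an idempotent `L` of trace `h`. The real projection `Q =
cyclicProj c x y`, built from the partition and the positive eigenvectors, also has trace `h` and
satisfies `L * Q = Q * L = Q`. So `L - Q` is an idempotent of trace zero and `L = Q`. Hence `A ^ (h
* q + s)` tends to `Q * A ^ s`, which is positive exactly where `c j = c i + s`; elsewhere the power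
is zero already (`eventuallyNonneg_of_hasCyclicJordanForm`).

Conversely, the rank condition gives `A = A ^ 2 * g(A)` for a polynomial `g`, so `A` is a
combination of arbitrarily high powers of itself. With irreducibility, some sum `B` of nonnegative
powers is then entrywise positive. Perron's theorem for `B`, which commutes with `A`, yields the
positive eigenvectors.

If `A z = μ z` with `|μ| = 1`, then `|z|` is a multiple of `y`, and equality in the triangle
inequality makes the phase of `z` change by `μ ^ k` along every arc of a high power `A ^ k`. The
rank condition transfers this to the arcs of `A` (`phase_of_phase_pow`), and maximality of `h`
forces `μ ^ h = 1`. So every peripheral eigenvector is a multiple of some `cyclicVec`. The kernel of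
`classSum` is an invariant complement of the span of these `h` vectors; there all eigenvalues lie
inside the unit disc, and a Jordan basis of it completes `Z`. -/

namespace EvNonneg

/-! ### Jordan normal form from modules over `ℂ[X]`. -/

open Polynomial in
-- The substitution `X ↦ X + a` turns the powers of `X - a` into distinct monomials of degree below
-- `m`, and divisibility by `(X - a) ^ m` into divisibility by `X ^ m`.
theorem linearIndependent_mk_X_sub_C_pow {K : Type*} [Field K] (a : K) (m : ℕ) :
    LinearIndependent K (fun j : Fin m =>
      (Submodule.Quotient.mk ((X - C a) ^ (m - 1 - (j : ℕ))) :
        K[X] ⧸ K[X] ∙ (X - C a) ^ m)) := by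
  rw [Fintype.linearIndependent_iff]
  intro g hg i
  have h1 : (Submodule.Quotient.mk (∑ j : Fin m, g j • (X - C a) ^ (m - 1 - (j : ℕ))) :
        K[X] ⧸ K[X] ∙ (X - C a) ^ m) = 0 := by
    rw [← hg, ← Submodule.mkQ_apply, map_sum]
    rfl
  rw [Submodule.Quotient.mk_eq_zero, Submodule.mem_span_singleton] at h1
  obtain ⟨q, hq⟩ := h1
  have h2 : (X - C a) ^ m ∣ ∑ j : Fin m, g j • (X - C a) ^ (m - 1 - (j : ℕ)) :=
    ⟨q, by rw [← hq, smul_eq_mul, mul_comm]⟩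
  rw [X_sub_C_pow_dvd_iff, X_pow_dvd_iff] at h2
  have h3 := h2 (m - 1 - (i : ℕ)) (by have := i.2; omega)
  simp only [Polynomial.sum_comp, smul_comp, pow_comp, sub_comp, X_comp, C_comp,
    add_sub_cancel_right, finsetSum_coeff, coeff_smul, coeff_X_pow, smul_eq_mul] at h3
  rw [Finset.sum_eq_single i] at h3
  · simpa using h3
  · intro b _ hb
    have := i.2
    have := b.2
    have : (b : ℕ) ≠ i := fun h => hb (Fin.ext h)
    rw [if_neg (by omega), mul_zero]
  · simp

open Polynomial in
theorem exists_basis_quotient_X_sub_C_pow {K : Type*} [Field K] (a : K) (m : ℕ) :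
    ∃ b : Module.Basis (Fin m) K (K[X] ⧸ K[X] ∙ (X - C a) ^ m),
      ∀ j, (b j) = Submodule.Quotient.mk ((X - C a) ^ (m - 1 - (j : ℕ))) := by
  have hfr : Module.finrank K (K[X] ⧸ K[X] ∙ (X - C a) ^ m) = m := by
    have := finrank_quotient_span_eq_natDegree (f := (X - C a) ^ m)
    rw [natDegree_pow, natDegree_X_sub_C, mul_one] at this
    exact this
  rcases Nat.eq_zero_or_pos m with rfl | hm
  · have : Subsingleton (K[X] ⧸ K[X] ∙ (X - C a) ^ 0) := by
      rw [Submodule.Quotient.subsingleton_iff, pow_zero]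
      exact Ideal.span_singleton_one
    exact ⟨Module.Basis.empty _, fun j => j.elim0⟩
  · have : Nonempty (Fin m) := ⟨⟨0, hm⟩⟩
    refine ⟨basisOfLinearIndependentOfCardEqFinrank (linearIndependent_mk_X_sub_C_pow a m)
      (by rw [hfr, Fintype.card_fin]), fun j => ?_⟩
    simp

open Polynomial in
-- Multiplication by `X` sends `(X - a) ^ e` to `a (X - a) ^ e + (X - a) ^ (e + 1)`. Listing the
-- exponents in decreasing order makes the block upper triangular; for `j = 0` the last term is `(X
-- - a) ^ m = 0`.
theorem exists_jordan_basis_quotient (a : ℂ) (m : ℕ) (S : Submodule ℂ[X] ℂ[X])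
    (hS : S = ℂ[X] ∙ (X - C a) ^ m) :
    ∃ b : Module.Basis (Fin m) ℂ (ℂ[X] ⧸ S),
      ∀ j, (X : ℂ[X]) • b j = ∑ i, jordanBlock m a i j • b i := by
  subst hS
  obtain ⟨b, hb⟩ := exists_basis_quotient_X_sub_C_pow a m
  refine ⟨b, fun j => ?_⟩
  have hX : (X : ℂ[X]) • b j = a • b j +
      (Submodule.Quotient.mk ((X - C a) ^ (m - (j : ℕ))) : ℂ[X] ⧸ ℂ[X] ∙ (X - C a) ^ m) := by
    rw [hb, ← Submodule.Quotient.mk_smul, ← Submodule.Quotient.mk_smul,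
      ← Submodule.Quotient.mk_add]
    congr 1
    have : m - (j : ℕ) = (m - 1 - j) + 1 := by have := j.2; omega
    rw [this, pow_succ, smul_eq_C_mul, smul_eq_mul]
    ring
  rw [hX]
  by_cases hj : (j : ℕ) = 0
  · have h0 : (Submodule.Quotient.mk ((X - C a) ^ (m - (j : ℕ))) :
        ℂ[X] ⧸ ℂ[X] ∙ (X - C a) ^ m) = 0 := by
      rw [Submodule.Quotient.mk_eq_zero, hj]
      exact Submodule.mem_span_singleton_self _
    rw [h0, add_zero, Finset.sum_eq_single j]
    · simp [jordanBlock]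
    · intro i _ hi
      simp [jordanBlock, hi, hj]
    · simp
  · have hlt : (j : ℕ) - 1 < m := by have := j.2; omega
    have h1 : (Submodule.Quotient.mk ((X - C a) ^ (m - (j : ℕ))) :
        ℂ[X] ⧸ ℂ[X] ∙ (X - C a) ^ m) = b ⟨(j : ℕ) - 1, hlt⟩ := by
      rw [hb]
      congr 2
      simp only
      omega
    have hne : j ≠ ⟨(j : ℕ) - 1, hlt⟩ := by
      intro h
      have := congrArg Fin.val h
      simp only at this
      omega
    rw [h1, Finset.sum_eq_add j ⟨(j : ℕ) - 1, hlt⟩ hne]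
    · have : (j : ℕ) - 1 + 1 = j := by omega
      simp [jordanBlock, hne.symm, this]
    · rintro i _ ⟨hi, hi'⟩
      have : (i : ℕ) + 1 ≠ j := fun h => hi' (Fin.ext (by simp only; omega))
      simp [jordanBlock, hi, this]
    · simp
    · simp

open Polynomial in
theorem exists_span_pow_eq_of_irreducible {p : ℂ[X]} (hp : Irreducible p) (m : ℕ) :
    ∃ a : ℂ, ℂ[X] ∙ p ^ m = ℂ[X] ∙ (X - C a) ^ m := by
  have hd := IsAlgClosed.degree_eq_one_of_irreducible ℂ hp
  obtain ⟨a, ha⟩ := exists_root_of_degree_eq_one hd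
  refine ⟨a, ?_⟩
  have : Associated p (X - C a) :=
    (((irreducible_X_sub_C a).associated_of_dvd hp) (dvd_iff_isRoot.2 ha)).symm
  exact Ideal.span_singleton_eq_span_singleton.2 (this.pow_pow)

open Polynomial in
-- With `X` acting as `f`, the space is a torsion `ℂ[X]`-module, hence a direct sum of quotients by
-- powers of irreducible polynomials, which are linear over `ℂ`.
theorem exists_jordan_basis_sigma {W : Type} [AddCommGroup W] [Module ℂ W] [Module.Finite ℂ W]
    (f : W →ₗ[ℂ] W) :
    ∃ (ι : Type) (_ : Fintype ι) (r : ι → ℕ) (μ : ι → ℂ)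
      (b : Module.Basis (Σ s : ι, Fin (r s)) ℂ W),
      ∀ s j, f (b ⟨s, j⟩) = ∑ i, jordanBlock (r s) (μ s) i j • b ⟨s, i⟩ := by
  classical
  obtain ⟨ι, hι, p, hp, r, ⟨e⟩⟩ := Module.equiv_directSum_of_isTorsion
    (R := ℂ[X]) (M := Module.AEval' f) (Module.AEval.isTorsion_of_finiteDimensional ℂ W f)
  choose μ hμ using fun i => exists_span_pow_eq_of_irreducible (hp i) (r i)
  choose b hb using fun i => exists_jordan_basis_quotient (μ i) (r i) _ (hμ i)
  let E : (Π₀ i, ℂ[X] ⧸ ℂ[X] ∙ p i ^ r i) ≃ₗ[ℂ] Module.AEval' f := e.symm.restrictScalars ℂ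
  let B := ((DFinsupp.basis b).map E).map (Module.AEval'.of f).symm
  have hB : ∀ s j, B ⟨s, j⟩ = (Module.AEval'.of f).symm (e.symm (DFinsupp.single s (b s j))) := by
    intro s j
    simp [B, E, DFinsupp.basis]
  refine ⟨ι, hι, r, μ, B, fun s j => ?_⟩
  have hsum : (DFinsupp.single s (∑ i, jordanBlock (r s) (μ s) i j • b s i) :
      Π₀ i, ℂ[X] ⧸ ℂ[X] ∙ p i ^ r i) =
      ∑ i, jordanBlock (r s) (μ s) i j • DFinsupp.single s (b s i) := by
    have := map_sum (DFinsupp.lsingle (R := ℂ) (M := fun i => ℂ[X] ⧸ ℂ[X] ∙ p i ^ r i) s)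
      (fun i => jordanBlock (r s) (μ s) i j • b s i) Finset.univ
    simp only [map_smul] at this
    exact this
  have hX : (X : ℂ[X]) • (DFinsupp.single s (b s j) : Π₀ i, ℂ[X] ⧸ ℂ[X] ∙ p i ^ r i) =
      ∑ i, jordanBlock (r s) (μ s) i j • DFinsupp.single s (b s i) := by
    rw [← hsum, ← hb s j, DFinsupp.single_smul]
  have hE : e.symm ((X : ℂ[X]) • (DFinsupp.single s (b s j) : Π₀ i, ℂ[X] ⧸ ℂ[X] ∙ p i ^ r i)) =
      ∑ i, jordanBlock (r s) (μ s) i j • e.symm (DFinsupp.single s (b s i)) := by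
    have := congrArg E hX
    rw [map_sum] at this
    simp only [map_smul] at this
    exact this
  rw [hB, ← Module.AEval'.of_symm_X_smul, ← map_smul, hE, map_sum]
  simp only [map_smul, hB]

/-- **Jordan normal form** of an endomorphism, as the existence of a Jordan basis. -/
theorem exists_jordan_basis {W : Type} [AddCommGroup W] [Module ℂ W] [Module.Finite ℂ W]
    (f : W →ₗ[ℂ] W) :
    ∃ (t : ℕ) (r : Fin t → ℕ) (μ : Fin t → ℂ)
      (b : Module.Basis (Σ s : Fin t, Fin (r s)) ℂ W),
      (∀ s, 0 < r s) ∧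
      ∀ s j, f (b ⟨s, j⟩) = ∑ i, jordanBlock (r s) (μ s) i j • b ⟨s, i⟩ := by
  classical
  obtain ⟨ι, hι, r, μ, b, hb⟩ := exists_jordan_basis_sigma f
  -- The decomposition may contain trivial summands with exponent zero; they are dropped here.
  let σ := (Fintype.equivFin {i : ι // 0 < r i}).symm
  let F : (Σ s, Fin (r (σ s).1)) → Σ s : ι, Fin (r s) := fun x => ⟨(σ x.1).1, x.2⟩
  have hF : Function.Bijective F := by
    constructor
    · rintro ⟨s, j⟩ ⟨s', j'⟩ h
      have h1 : (σ s).1 = (σ s').1 := congrArg Sigma.fst h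
      have h2 : s = s' := σ.injective (Subtype.ext h1)
      subst h2
      simpa [F] using h
    · rintro ⟨s, j⟩
      obtain ⟨s', hs'⟩ := σ.surjective ⟨s, j.pos⟩
      have h1 : (σ s').1 = s := congrArg Subtype.val hs'
      subst h1
      exact ⟨⟨s', j⟩, rfl⟩
  refine ⟨_, fun s => r (σ s).1, fun s => μ (σ s).1,
    b.reindex (Equiv.ofBijective F hF).symm, fun s => (σ s).2, fun s j => ?_⟩
  simpa [F] using hb (σ s).1 j

/-! ### Limits of powers, and idempotents of trace zero. -/

open Filter Topology

theorem tendsto_pow_zero_of_spectralRadius_lt_one {ι : Type*} [Fintype ι] [DecidableEq ι]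
    (J : Matrix ι ι ℂ) (hJ : spectralRadius ℂ J < 1) :
    Tendsto (fun m : ℕ => J ^ m) atTop (𝓝 0) := by
  let _ : NormedRing (Matrix ι ι ℂ) := Matrix.linftyOpNormedRing
  let _ : NormedAlgebra ℂ (Matrix ι ι ℂ) := Matrix.linftyOpNormedAlgebra
  have : CompleteSpace (Matrix ι ι ℂ) := FiniteDimensional.complete ℂ _
  have hg := spectrum.pow_nnnorm_pow_one_div_tendsto_nhds_spectralRadius J
  obtain ⟨r, hr1, hr2⟩ := ENNReal.lt_iff_exists_nnreal_btwn.1 hJ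
  have hr2' : r < 1 := by exact_mod_cast hr2
  -- Gelfand's formula: the `m`-th roots of `‖J ^ m‖` are eventually below `r < 1`.
  have hev : ∀ᶠ m : ℕ in atTop, ‖J ^ m‖ ≤ (r : ℝ) ^ m := by
    filter_upwards [hg.eventually_lt_const hr1, eventually_gt_atTop 0] with m hm hm0
    have hm0' : (m : ℝ) ≠ 0 := by positivity
    have h1 : (‖J ^ m‖₊ : ENNReal) ≤ (r : ENNReal) ^ (m : ℝ) := by
      have := ENNReal.rpow_le_rpow hm.le (Nat.cast_nonneg m : (0 : ℝ) ≤ m)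
      rwa [← ENNReal.rpow_mul, one_div, inv_mul_cancel₀ hm0', ENNReal.rpow_one] at this
    rw [ENNReal.rpow_natCast] at h1
    exact_mod_cast h1
  have hz : Tendsto (fun m : ℕ => (r : ℝ) ^ m) atTop (𝓝 0) :=
    tendsto_pow_atTop_nhds_zero_of_lt_one r.2 (by exact_mod_cast hr2')
  exact squeeze_zero_norm' hev hz

theorem eq_zero_of_isIdempotentElem_of_trace_eq_zero {ι : Type*} [Fintype ι] [DecidableEq ι]
    {M : Matrix ι ι ℂ} (hM : IsIdempotentElem M) (ht : M.trace = 0) : M = 0 := by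
  have h1 : IsIdempotentElem (Matrix.toLin' M) := by
    have := Matrix.toLin'_mul M M
    rw [hM.eq] at this
    exact this.symm
  have h2 := (LinearMap.IsIdempotentElem.trace_eq_zero_iff h1).1
    (by rw [Matrix.trace_toLin'_eq, ht])
  exact (LinearEquiv.map_eq_zero_iff _).1 h2

/-! ### The projection attached to a cyclic partition. -/

section Cyclic

variable {n h : ℕ} {A : Matrix (Fin n) (Fin n) ℝ} {c : Fin n → ZMod h}

theorem pow_apply_ne_zero_of_arcs (hc : ∀ i j, A i j ≠ 0 → c j = c i + 1) (m : ℕ) :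
    ∀ i j, (A ^ m) i j ≠ 0 → c j = c i + m := by
  induction m with
  | zero =>
    intro i j hij
    by_cases h : i = j
    · simp [h]
    · simp [h] at hij
  | succ m ih =>
    intro i j hij
    rw [pow_succ, Matrix.mul_apply] at hij
    obtain ⟨k, -, hk⟩ := Finset.exists_ne_zero_of_sum_ne_zero hij
    rw [hc k j (right_ne_zero_of_mul hk), ih i k (left_ne_zero_of_mul hk)]
    push_cast
    ring

theorem pow_mulVec_eq {y : Fin n → ℝ} (hy : A *ᵥ y = y) (m : ℕ) : (A ^ m) *ᵥ y = y := by
  induction m with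
  | zero => simp
  | succ m ih => rw [pow_succ, ← Matrix.mulVec_mulVec, hy, ih]

theorem vecMul_pow_eq {x : Fin n → ℝ} (hx : x ᵥ* A = x) (m : ℕ) : x ᵥ* (A ^ m) = x := by
  induction m with
  | zero => simp
  | succ m ih => rw [pow_succ, ← Matrix.vecMul_vecMul, ih, hx]

/-- The scalar product of `x` and `y` over the class `l` of the partition `c`. -/
def classDot (c : Fin n → ZMod h) (x y : Fin n → ℝ) (l : ZMod h) : ℝ :=
  ∑ j, if c j = l then x j * y j else 0

theorem classDot_pos (hs : Function.Surjective c) {x y : Fin n → ℝ}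
    (hx : ∀ i, 0 < x i) (hy : ∀ i, 0 < y i) (l : ZMod h) : 0 < classDot c x y l := by
  obtain ⟨j, hj⟩ := hs l
  refine Finset.sum_pos' (fun i _ => ?_) ⟨j, Finset.mem_univ j, ?_⟩
  · split_ifs
    · exact (mul_pos (hx i) (hy i)).le
    · exact le_rfl
  · rw [if_pos hj]
    exact mul_pos (hx j) (hy j)

/-- The projection onto the vectors that are multiples of `y` on every class of `c`, along those
that are orthogonal to `x` on every class. -/
noncomputable def cyclicProj (c : Fin n → ZMod h) (x y : Fin n → ℝ) :
    Matrix (Fin n) (Fin n) ℝ :=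
  Matrix.of fun i j => if c i = c j then y i * x j / classDot c x y (c i) else 0

/-- Each column of `cyclicProj` is a multiple of `y` restricted to one class, and a matrix that
preserves the classes and fixes `y` fixes these restrictions. -/
theorem mul_cyclicProj {N : Matrix (Fin n) (Fin n) ℝ} (hN : ∀ i j, N i j ≠ 0 → c j = c i)
    {x y : Fin n → ℝ} (hy : N *ᵥ y = y) : N * cyclicProj c x y = cyclicProj c x y := by
  ext i j
  have h1 : ∀ k, N i k * cyclicProj c x y k j =
      (if c i = c j then x j / classDot c x y (c i) else 0) * (N i k * y k) := by
    intro k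
    by_cases hk : N i k = 0
    · simp [hk]
    · simp only [cyclicProj, Matrix.of_apply, hN i k hk]
      split_ifs <;> ring
  have h2 : ∑ k, N i k * y k = y i := congrFun hy i
  rw [Matrix.mul_apply, Finset.sum_congr rfl fun k _ => h1 k, ← Finset.mul_sum, h2]
  simp only [cyclicProj, Matrix.of_apply]
  split_ifs <;> ring

/-- For `N = A ^ s` this computes the limit of `A ^ (h * q + s)`. -/
theorem cyclicProj_mul {N : Matrix (Fin n) (Fin n) ℝ} {s : ZMod h}
    (hN : ∀ i j, N i j ≠ 0 → c j = c i + s)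
    {x y : Fin n → ℝ} (hx : x ᵥ* N = x) (i j : Fin n) :
    (cyclicProj c x y * N) i j =
      if c j = c i + s then y i * x j / classDot c x y (c i) else 0 := by
  have h1 : ∀ k, cyclicProj c x y i k * N k j =
      (if c j = c i + s then y i / classDot c x y (c i) else 0) * (x k * N k j) := by
    intro k
    by_cases hk : N k j = 0
    · simp [hk]
    · simp only [cyclicProj, Matrix.of_apply, hN k j hk, add_left_inj, eq_comm (a := c k)]
      split_ifs <;> ring
  have h2 : ∑ k, x k * N k j = x j := congrFun hx j
  rw [Matrix.mul_apply, Finset.sum_congr rfl fun k _ => h1 k, ← Finset.mul_sum, h2]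
  split_ifs <;> ring

theorem cyclicProj_mul_self (hs : Function.Surjective c) {x y : Fin n → ℝ}
    (hx : ∀ i, 0 < x i) (hy : ∀ i, 0 < y i) :
    cyclicProj c x y * cyclicProj c x y = cyclicProj c x y := by
  refine mul_cyclicProj (fun i j hij => ?_) ?_
  · by_contra hne
    exact hij (by simp [cyclicProj, Ne.symm hne])
  · ext i
    have h1 : ∀ k, cyclicProj c x y i k * y k =
        (y i / classDot c x y (c i)) * (if c k = c i then x k * y k else 0) := by
      intro k
      simp only [cyclicProj, Matrix.of_apply, eq_comm (a := c i)]
      split_ifs <;> ring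
    change ∑ k, cyclicProj c x y i k * y k = y i
    rw [Finset.sum_congr rfl fun k _ => h1 k, ← Finset.mul_sum]
    exact div_mul_cancel₀ _ (classDot_pos hs hx hy (c i)).ne'

theorem trace_cyclicProj [NeZero h] (hs : Function.Surjective c) {x y : Fin n → ℝ}
    (hx : ∀ i, 0 < x i) (hy : ∀ i, 0 < y i) : (cyclicProj c x y).trace = h := by
  have h1 : ∀ i, cyclicProj c x y i i =
      ∑ l : ZMod h, (if c i = l then x i * y i else 0) / classDot c x y l := by
    intro i
    rw [Finset.sum_eq_single (c i)]
    · simp [cyclicProj, mul_comm]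
    · intro b _ hb
      simp [hb.symm]
    · simp
  rw [Matrix.trace]
  simp only [Matrix.diag_apply]
  rw [Finset.sum_congr rfl fun i _ => h1 i, Finset.sum_comm]
  have h2 : ∀ l : ZMod h,
      ∑ i, (if c i = l then x i * y i else 0) / classDot c x y l = 1 := by
    intro l
    rw [← Finset.sum_div]
    exact div_self (classDot_pos hs hx hy l).ne'
  rw [Finset.sum_congr rfl fun l _ => h2 l]
  simp [ZMod.card]

end Cyclic

/-! ### From (C) to eventual nonnegativity. -/

theorem toComplex_pow {n : ℕ} (A : Matrix (Fin n) (Fin n) ℝ) (m : ℕ) :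
    toComplex (A ^ m) = toComplex A ^ m :=
  map_pow (Complex.ofRealHom.mapMatrix) A m

theorem toComplex_mul {n : ℕ} (A B : Matrix (Fin n) (Fin n) ℝ) :
    toComplex (A * B) = toComplex A * toComplex B :=
  map_mul (Complex.ofRealHom.mapMatrix) A B

theorem trace_toComplex {n : ℕ} (A : Matrix (Fin n) (Fin n) ℝ) :
    (toComplex A).trace = (A.trace : ℂ) := by
  simp [toComplex, Matrix.trace]

theorem cyclicDiagonal_pow_mul {h : ℕ} (h0 : h ≠ 0) (q : ℕ) : cyclicDiagonal h ^ (h * q) = 1 := by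
  have hω : Complex.exp (2 * Real.pi * Complex.I / h) ^ h = 1 :=
    (Complex.isPrimitiveRoot_exp h h0).pow_eq_one
  rw [cyclicDiagonal, Matrix.diagonal_pow, ← Matrix.diagonal_one]
  congr 1
  ext k
  rw [Pi.pow_apply, pow_right_comm, pow_mul, hω, one_pow, one_pow]

theorem HasCyclicJordanForm.exists_tendsto {n h : ℕ} {A : Matrix (Fin n) (Fin n) ℝ} (h0 : h ≠ 0)
    (hJ : HasCyclicJordanForm A h) :
    ∃ L : Matrix (Fin n) (Fin n) ℂ, IsIdempotentElem L ∧ L.trace = h ∧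
      Tendsto (fun q : ℕ => toComplex A ^ (h * q)) atTop (𝓝 L) := by
  obtain ⟨t, r, μ, e, Z, -, hZ, hAZ, hρ⟩ := hJ
  have hZd : IsUnit Z.det := (Matrix.isUnit_iff_isUnit_det Z).1 hZ
  have hZ1 : Z⁻¹ * Z = 1 := Matrix.nonsing_inv_mul Z hZd
  have hZ2 : Z * Z⁻¹ = 1 := Matrix.mul_nonsing_inv Z hZd
  set F : Matrix (Fin h) (Fin h) ℂ → Matrix (Σ s : Fin t, Fin (r s)) (Σ s : Fin t, Fin (r s)) ℂ →
    Matrix (Fin n) (Fin n) ℂ :=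
    fun D M => Z * (Matrix.fromBlocks D 0 0 M).submatrix e e * Z⁻¹ with hF
  have hmul : ∀ D D' M M', F D M * F D' M' = F (D * D') (M * M') := by
    intro D D' M M'
    have h1 : (Matrix.fromBlocks (D * D') 0 0 (M * M')).submatrix e e =
        (Matrix.fromBlocks D 0 0 M).submatrix e e * (Matrix.fromBlocks D' 0 0 M').submatrix e e := by
      rw [Matrix.submatrix_mul_equiv, Matrix.fromBlocks_multiply]
      simp
    simp only [hF, h1]
    calc _ = Z * (Matrix.fromBlocks D 0 0 M).submatrix e e * (Z⁻¹ * Z) *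
          (Matrix.fromBlocks D' 0 0 M').submatrix e e * Z⁻¹ := by noncomm_ring
      _ = _ := by rw [hZ1]; noncomm_ring
  have hA : toComplex A = F (cyclicDiagonal h) (jordanMatrix r μ) := by
    simp only [hF, ← hAZ]
    calc _ = (Z * Z⁻¹) * toComplex A * (Z * Z⁻¹) := by rw [hZ2]; simp
      _ = _ := by noncomm_ring
  have hpow : ∀ m, toComplex A ^ m = F (cyclicDiagonal h ^ m) (jordanMatrix r μ ^ m) := by
    intro m
    induction m with
    | zero => simp [hF, Matrix.fromBlocks_one, hZ2]
    | succ m ih => rw [pow_succ, pow_succ, pow_succ, ih, hA, hmul]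
  have hcont : Continuous (F 1) := by
    simp only [hF]
    exact (continuous_const.mul ((continuous_const.matrix_fromBlocks continuous_const
      continuous_const continuous_id).matrix_submatrix e e)).mul continuous_const
  refine ⟨F 1 0, ?_, ?_, ?_⟩
  · rw [IsIdempotentElem, hmul, one_mul, zero_mul]
  · simp only [hF]
    rw [Matrix.trace_mul_comm, ← Matrix.mul_assoc, hZ1, one_mul]
    simp only [Matrix.trace, Matrix.diag_apply, Matrix.submatrix_apply]
    rw [Equiv.sum_comp e (fun i => Matrix.fromBlocks (1 : Matrix (Fin h) (Fin h) ℂ) 0 0 0 i i)]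
    simp
  · have h1 : Tendsto (fun q : ℕ => jordanMatrix r μ ^ (h * q)) atTop (𝓝 0) :=
      (tendsto_pow_zero_of_spectralRadius_lt_one _ hρ).comp
        (tendsto_id.const_mul_atTop' (Nat.pos_of_ne_zero h0))
    have h2 := (hcont.tendsto 0).comp h1
    refine h2.congr fun q => ?_
    rw [Function.comp_apply, hpow, cyclicDiagonal_pow_mul h0]

theorem tendsto_pow_cyclicProj {n h : ℕ} [NeZero h] {A : Matrix (Fin n) (Fin n) ℝ}
    {c : Fin n → ZMod h} (hc : DescribesCyclic A h c) (hJ : HasCyclicJordanForm A h)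
    {x y : Fin n → ℝ} (hx : ∀ i, 0 < x i) (hxA : x ᵥ* A = x) (hy : ∀ i, 0 < y i)
    (hyA : A *ᵥ y = y) :
    Tendsto (fun q : ℕ => A ^ (h * q)) atTop (𝓝 (cyclicProj c x y)) := by
  obtain ⟨L, hL, htr, hlim⟩ := hJ.exists_tendsto (NeZero.ne h)
  set Q := toComplex (cyclicProj c x y) with hQ
  have harc : ∀ (q : ℕ) i j, (A ^ (h * q)) i j ≠ 0 → c j = c i := by
    intro q i j hij
    simpa using pow_apply_ne_zero_of_arcs hc.2 _ i j hij
  have hAQ : ∀ q, toComplex A ^ (h * q) * Q = Q := by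
    intro q
    rw [hQ, ← toComplex_pow, ← toComplex_mul, mul_cyclicProj (harc q) (pow_mulVec_eq hyA _)]
  have hQA : ∀ q, Q * toComplex A ^ (h * q) = Q := by
    intro q
    rw [hQ, ← toComplex_pow, ← toComplex_mul]
    congr 1
    ext i j
    rw [cyclicProj_mul (s := 0) (by simpa using harc q) (vecMul_pow_eq hxA _)]
    simp [cyclicProj, eq_comm]
  have hLQ : L * Q = Q := by
    refine tendsto_nhds_unique (hlim.mul_const Q) ?_
    simp only [hAQ]
    exact tendsto_const_nhds
  have hQL : Q * L = Q := by
    refine tendsto_nhds_unique (hlim.const_mul Q) ?_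
    simp only [hQA]
    exact tendsto_const_nhds
  have hQQ : Q * Q = Q := by
    rw [hQ, ← toComplex_mul, cyclicProj_mul_self hc.1 hx hy]
  have hLeq : L = Q := by
    -- `L - Q` is idempotent, and its trace is `h - h = 0`.
    rw [← sub_eq_zero]
    apply eq_zero_of_isIdempotentElem_of_trace_eq_zero
    · rw [IsIdempotentElem, sub_mul, mul_sub, mul_sub, hLQ, hQL, hQQ, hL.eq]
      simp
    · rw [Matrix.trace_sub, htr, hQ, trace_toComplex, trace_cyclicProj hc.1 hx hy]
      simp
  rw [hLeq, hQ] at hlim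
  have hre := ((continuous_id.matrix_map Complex.continuous_re).tendsto _).comp hlim
  have hmap : ∀ M : Matrix (Fin n) (Fin n) ℝ, (toComplex M).map Complex.re = M := by
    intro M
    ext i j
    simp [toComplex]
  simp only [Function.comp_def, id, ← toComplex_pow, hmap] at hre
  exact hre

theorem eventuallyNonneg_of_hasCyclicJordanForm {n h : ℕ} [NeZero h]
    {A : Matrix (Fin n) (Fin n) ℝ}
    {c : Fin n → ZMod h} (hc : DescribesCyclic A h c) (hJ : HasCyclicJordanForm A h)
    (hpos : HasPositiveEigenvectors A) : EventuallyNonneg A := by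
  obtain ⟨⟨x, hx, hxA⟩, y, hy, hyA⟩ := hpos
  have hlim := tendsto_pow_cyclicProj hc hJ hx hxA hy hyA
  have key : ∀ (s : Fin h) (i j : Fin n), ∀ᶠ q : ℕ in atTop,
      0 ≤ (A ^ (h * q + (s : ℕ))) i j := by
    intro s i j
    -- In the residue class of `s` modulo `h`, an entry either has a positive limit or vanishes
    -- identically.
    by_cases hij : c j = c i + ((s : ℕ) : ZMod h)
    · have h1 := ((hlim.mul_const (A ^ (s : ℕ))).apply_nhds i).apply_nhds j
      rw [cyclicProj_mul (pow_apply_ne_zero_of_arcs hc.2 _) (vecMul_pow_eq hxA _), if_pos hij] at h1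
      have h2 : 0 < y i * x j / classDot c x y (c i) :=
        div_pos (mul_pos (hy i) (hx j)) (classDot_pos hc.1 hx hy _)
      filter_upwards [h1.eventually_const_lt h2] with q hq
      rw [pow_add]
      exact hq.le
    · refine Eventually.of_forall fun q => ?_
      by_contra hne
      apply hij
      simpa using pow_apply_ne_zero_of_arcs hc.2 _ i j (fun h0 => hne h0.ge)
  obtain ⟨q, hq⟩ := eventually_atTop.1
    (eventually_all.2 fun s => eventually_all.2 fun i => eventually_all.2 fun j => key s i j)
  refine ⟨h * q, fun k hk i j => ?_⟩
  have h1 := hq (k / h) ((Nat.le_div_iff_mul_le (NeZero.pos h)).2 (by rwa [mul_comm]))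
    ⟨k % h, Nat.mod_lt _ (NeZero.pos h)⟩ i j
  simpa only [Nat.div_add_mod] using h1

/-! ### Eigenvalues; irreducibility as reachability. -/

theorem mem_spectrum_iff_exists_mulVec_eq {ι : Type*} [Fintype ι] [DecidableEq ι]
    {M : Matrix ι ι ℂ} {μ : ℂ} :
    μ ∈ spectrum ℂ M ↔ ∃ z : ι → ℂ, z ≠ 0 ∧ M *ᵥ z = μ • z := by
  rw [spectrum.mem_iff, Matrix.isUnit_iff_isUnit_det, isUnit_iff_ne_zero, not_not,
    ← Matrix.exists_mulVec_eq_zero_iff]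
  refine exists_congr fun z => and_congr_right fun _ => ?_
  rw [Matrix.sub_mulVec, sub_eq_zero, Matrix.algebraMap_eq_diagonal, eq_comm]
  have : (Matrix.diagonal (algebraMap ℂ (ι → ℂ) μ)) *ᵥ z = μ • z := by
    ext i
    simp [Matrix.mulVec_diagonal]
  rw [this]

section Irreducible

variable {n : ℕ} {A : Matrix (Fin n) (Fin n) ℝ}

/-- Listing the complement of an arc-closed set before the set itself would exhibit the forbidden
zero block. This serves as an induction principle along arcs. -/
theorem IsIrreducible.mem_of_closed (hA : IsIrreducible A) (S : Set (Fin n)) (hS : S.Nonempty)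
    (hcl : ∀ i j, i ∈ S → A i j ≠ 0 → j ∈ S) (j : Fin n) : j ∈ S := by
  classical
  by_contra hj
  apply hA
  let T : Finset (Fin n) := Finset.univ.filter fun i => i ∉ S
  have hT : ∀ i, i ∈ T ↔ i ∉ S := by simp [T]
  have hTn : T.card ≤ n := by simpa using T.card_le_univ
  have hTlt : T.card < n := by
    obtain ⟨i, hi⟩ := hS
    have : T ⊂ Finset.univ :=
      Finset.ssubset_univ_iff.2 fun h => (hT i).1 (h ▸ Finset.mem_univ i) hi
    simpa using Finset.card_lt_card this
  have hcard : Fintype.card {i : Fin n // (i : ℕ) < T.card} =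
      Fintype.card {i : Fin n // i ∉ S} := by
    rw [Fintype.card_subtype, Fintype.card_subtype, Fin.card_filter_val_lt, min_eq_right hTn]
  let E := Fintype.equivOfCardEq hcard
  let σ : Equiv.Perm (Fin n) := E.extendSubtype
  refine ⟨σ, T.card, Finset.card_pos.2 ⟨j, (hT j).2 hj⟩, hTlt, fun a b ha hb => ?_⟩
  have h1 : σ b ∉ S := Equiv.extendSubtype_mem E b hb
  have h2 : σ a ∈ S := not_not.1 (Equiv.extendSubtype_not_mem E a (not_lt.2 ha))
  by_contra hne
  exact h1 (hcl _ _ h2 hne)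

theorem IsIrreducible.exists_ne_zero (hA : IsIrreducible A) (hn : 1 < n) (i : Fin n) :
    ∃ j, A i j ≠ 0 := by
  by_contra! h
  have hall := hA.mem_of_closed {i} ⟨i, rfl⟩ (by
    rintro a b rfl hab
    exact absurd (h b) hab)
  obtain ⟨j, hj⟩ : ∃ j : Fin n, j ≠ i := by
    have : Nontrivial (Fin n) := Fin.nontrivial_iff_two_le.2 hn
    exact exists_ne i
  exact hj (hall j)

end Irreducible

/-! ### Consequences of the rank condition. -/

section Rank

variable {n : ℕ} {A : Matrix (Fin n) (Fin n) ℝ}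

theorem mul_eq_zero_of_rank_sq_eq (hr : (A ^ 2).rank = A.rank) {B : Matrix (Fin n) (Fin n) ℝ}
    (hB : A ^ 2 * B = 0) : A * B = 0 := by
  have hle : LinearMap.ker A.mulVecLin ≤ LinearMap.ker (A ^ 2).mulVecLin := by
    intro v hv
    rw [LinearMap.mem_ker, Matrix.mulVecLin_apply] at hv ⊢
    rw [pow_two, ← Matrix.mulVec_mulVec, hv, Matrix.mulVec_zero]
  have h1 := LinearMap.finrank_range_add_finrank_ker A.mulVecLin
  have h2 := LinearMap.finrank_range_add_finrank_ker (A ^ 2).mulVecLin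
  have heq : LinearMap.ker A.mulVecLin = LinearMap.ker (A ^ 2).mulVecLin := by
    apply Submodule.eq_of_le_of_finrank_eq hle
    unfold Matrix.rank at hr
    omega
  ext i j
  have hj : (fun k => B k j) ∈ LinearMap.ker A.mulVecLin := by
    rw [heq, LinearMap.mem_ker]
    ext k
    exact congrFun (congrFun hB k) j
  exact congrFun (LinearMap.mem_ker.1 hj) i

open Polynomial in
-- Write the characteristic polynomial as `X ^ k * q` with `q(0) ≠ 0`. As `A` and `A ^ 2` have the
-- same kernel, `A ^ k * q(A) = 0` descends to `A * q(A) = 0`, which is solved for the term `q(0) •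
-- A`.
theorem exists_aeval_of_rank_sq_eq (hr : (A ^ 2).rank = A.rank) :
    ∃ g : ℝ[X], A = A ^ 2 * aeval A g := by
  obtain ⟨q, hq, hq0⟩ := exists_eq_pow_rootMultiplicity_mul_and_not_dvd A.charpoly
    A.charpoly_monic.ne_zero 0
  rw [C_0, sub_zero] at hq hq0
  rw [X_dvd_iff] at hq0
  have hz : A ^ (A.charpoly.rootMultiplicity 0) * aeval A q = 0 := by
    have := A.aeval_self_charpoly
    rw [hq, map_mul, map_pow, aeval_X] at this
    exact this
  have hdesc : ∀ m : ℕ, A ^ m * aeval A q = 0 → A * aeval A q = 0 := by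
    intro m
    induction m with
    | zero => intro h; rw [pow_zero, one_mul] at h; rw [h, mul_zero]
    | succ m ih =>
      intro h
      rcases m with _ | m
      · simpa using h
      · apply ih
        rw [pow_succ', mul_assoc]
        apply mul_eq_zero_of_rank_sq_eq hr
        rw [← h, pow_succ' A (m + 1), pow_succ' A m, pow_two]
        simp only [mul_assoc]
  have h1 := hdesc _ hz
  have hpoly : X * q = X ^ 2 * divX q + C (q.coeff 0) * X := by
    conv_lhs => rw [← divX_mul_X_add q]
    ring
  have h2 : A ^ 2 * aeval A (divX q) + q.coeff 0 • A = 0 := by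
    have h3 := congrArg (aeval A) hpoly
    simp only [map_add, map_mul, map_pow, aeval_X, aeval_C, h1] at h3
    rw [h3, Algebra.smul_def]
  refine ⟨C (-(q.coeff 0)⁻¹) * divX q, ?_⟩
  rw [map_mul, aeval_C, ← Algebra.smul_def, mul_smul_comm, eq_neg_of_add_eq_zero_left h2,
    smul_neg, neg_smul, neg_neg, smul_smul, inv_mul_cancel₀ hq0, one_smul]

open Polynomial in
theorem eq_pow_mul_aeval_pow {g : ℝ[X]} (hg : A = A ^ 2 * aeval A g) (m : ℕ) :
    A = A ^ (m + 1) * aeval A g ^ m := by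
  induction m with
  | zero => simp
  | succ m ih =>
    calc A = A ^ (m + 1) * aeval A g ^ m := ih
      _ = A ^ m * A * aeval A g ^ m := by rw [pow_succ]
      _ = A ^ m * (A ^ 2 * aeval A g) * aeval A g ^ m := by rw [← hg]
      _ = A ^ (m + 1 + 1) * aeval A g ^ (m + 1) := by
        rw [pow_succ' (aeval A g) m, pow_succ A (m + 1), pow_succ A m, pow_two]
        simp only [mul_assoc]

open Polynomial in
-- `A` is a linear combination of powers with exponent above `p`, so they cannot all vanish at `(i,
-- j)`.
theorem exists_pow_apply_ne_zero {g : ℝ[X]} (hg : A = A ^ 2 * aeval A g) (p : ℕ) {i j : Fin n}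
    (hij : A i j ≠ 0) : ∃ k, p ≤ k ∧ (A ^ k) i j ≠ 0 := by
  by_contra! h
  apply hij
  have h1 := congrFun (congrFun (eq_pow_mul_aeval_pow hg p) i) j
  rw [← map_pow, aeval_eq_sum_range, Finset.mul_sum, Matrix.sum_apply] at h1
  rw [h1]
  refine Finset.sum_eq_zero fun m _ => ?_
  rw [mul_smul_comm, ← pow_add, Matrix.smul_apply, h _ (by omega), smul_zero]

/-- In an irreducible matrix with `rank (A ^ 2) = rank A` whose powers from the `p`-th on are
nonnegative, every entry is positive in some such power. -/
theorem IsIrreducible.exists_pow_apply_pos (hA : IsIrreducible A) (hn : 1 < n)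
    (hr : (A ^ 2).rank = A.rank) {p : ℕ} (hp : ∀ k, p ≤ k → ∀ i j, 0 ≤ (A ^ k) i j)
    (i j : Fin n) : ∃ k, p ≤ k ∧ 0 < (A ^ k) i j := by
  obtain ⟨g, hg⟩ := exists_aeval_of_rank_sq_eq hr
  refine hA.mem_of_closed {j | ∃ k, p ≤ k ∧ 0 < (A ^ k) i j} ?_ ?_ j
  · obtain ⟨l, hl⟩ := hA.exists_ne_zero hn i
    obtain ⟨k, hk, hne⟩ := exists_pow_apply_ne_zero hg p hl
    exact ⟨l, k, hk, lt_of_le_of_ne (hp k hk i l) hne.symm⟩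
  · rintro a b ⟨k, hk, hpos⟩ hab
    obtain ⟨k', hk', hne⟩ := exists_pow_apply_ne_zero hg p hab
    refine ⟨k + k', by omega, ?_⟩
    rw [pow_add, Matrix.mul_apply]
    exact Finset.sum_pos' (fun m _ => mul_nonneg (hp k hk i m) (hp k' hk' m b))
      ⟨a, Finset.mem_univ a, mul_pos hpos (lt_of_le_of_ne (hp k' hk' a b) hne.symm)⟩

theorem IsIrreducible.exists_sum_pow_pos (hA : IsIrreducible A) (hn : 1 < n)
    (hr : (A ^ 2).rank = A.rank) {p : ℕ} (hp : ∀ k, p ≤ k → ∀ i j, 0 ≤ (A ^ k) i j) :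
    ∃ N, ∀ i j, 0 < (∑ k ∈ Finset.Icc p N, A ^ k) i j := by
  choose k hk hpos using hA.exists_pow_apply_pos hn hr hp
  refine ⟨Finset.univ.sup fun i => Finset.univ.sup fun j => k i j, fun i j => ?_⟩
  rw [Matrix.sum_apply]
  refine Finset.sum_pos' (fun m hm => hp m (Finset.mem_Icc.1 hm).1 i j)
    ⟨k i j, Finset.mem_Icc.2 ⟨hk i j, ?_⟩, hpos i j⟩
  exact (Finset.le_sup (f := fun j => k i j) (Finset.mem_univ j)).trans
    (Finset.le_sup (f := fun i => Finset.univ.sup fun j => k i j) (Finset.mem_univ i))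

end Rank

/-! ### Perron theory of positive matrices. -/

section Perron

variable {ι : Type*} [Fintype ι]

theorem mulVec_pos_of_pos {B : Matrix ι ι ℝ} (hB : ∀ i j, 0 < B i j) {v : ι → ℝ}
    (hv : ∀ i, 0 ≤ v i) (hv0 : v ≠ 0) (i : ι) : 0 < (B *ᵥ v) i := by
  obtain ⟨j, hj⟩ := Function.ne_iff.1 hv0
  exact Finset.sum_pos' (fun k _ => mul_nonneg (hB i k).le (hv k))
    ⟨j, Finset.mem_univ j, mul_pos (hB i j) (lt_of_le_of_ne (hv j) (Ne.symm hj))⟩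

/-- **Perron's theorem**: an entrywise positive matrix has a positive eigenvector. -/
theorem exists_pos_eigenvector_of_pos [Nonempty ι] {B : Matrix ι ι ℝ} (hB : ∀ i j, 0 < B i j) :
    ∃ (y : ι → ℝ) (t : ℝ), (∀ i, 0 < y i) ∧ 0 < t ∧ B *ᵥ y = t • y := by
  classical
  set m : ℝ := ∑ i, ∑ j, B i j with hm
  -- Collatz–Wielandt: maximise `t` subject to `t v ≤ B v` on the simplex. The bound `m` holds for
  -- every such `t` and makes the domain compact.
  let K : Set ((ι → ℝ) × ℝ) :=
    (stdSimplex ℝ ι ×ˢ Set.Icc 0 m) ∩ {q | ∀ i, q.2 * q.1 i ≤ (B *ᵥ q.1) i}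
  have hbound : ∀ v ∈ stdSimplex ℝ ι, ∀ t : ℝ, (∀ i, t * v i ≤ (B *ᵥ v) i) → t ≤ m := by
    rintro v ⟨hv0, hv1⟩ t ht
    have h1 : ∑ i, t * v i ≤ ∑ i, (B *ᵥ v) i := Finset.sum_le_sum fun i _ => ht i
    rw [← Finset.mul_sum, hv1, mul_one] at h1
    refine h1.trans (Finset.sum_le_sum fun i _ => Finset.sum_le_sum fun j _ => ?_)
    have : v j ≤ 1 := by
      rw [← hv1]
      exact Finset.single_le_sum (fun k _ => hv0 k) (Finset.mem_univ j)
    exact mul_le_of_le_one_right (hB i j).le this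
  have hclosed : IsClosed {q : (ι → ℝ) × ℝ | ∀ i, q.2 * q.1 i ≤ (B *ᵥ q.1) i} := by
    simp only [Set.ofPred_forall]
    refine isClosed_iInter fun i => isClosed_le ?_ ?_
    · fun_prop
    · exact (continuous_apply i).comp (continuous_const.matrix_mulVec continuous_fst)
  have hK : IsCompact K := ((isCompact_stdSimplex ℝ ι).prod isCompact_Icc).inter_right hclosed
  have hKne : K.Nonempty := by
    obtain ⟨i0⟩ := ‹Nonempty ι›
    have hs := single_mem_stdSimplex ℝ i0
    refine ⟨(Pi.single i0 1, 0), ⟨hs, le_rfl, ?_⟩, fun i => ?_⟩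
    · exact Finset.sum_nonneg fun i _ => Finset.sum_nonneg fun j _ => (hB i j).le
    · rw [zero_mul]
      exact Finset.sum_nonneg fun j _ => mul_nonneg (hB i j).le (hs.1 j)
  obtain ⟨⟨v, t⟩, ⟨⟨hv, ht⟩, hvt⟩, hmax⟩ := hK.exists_isMaxOn hKne continuous_snd.continuousOn
  simp only at hv ht
  have hv0 : v ≠ 0 := by
    rintro rfl
    simpa using hv.2
  have hw := mulVec_pos_of_pos hB hv.1 hv0
  have heq : B *ᵥ v = t • v := by
    by_contra hne
    -- If `B v ≠ t v`, applying `B` makes the inequality strict everywhere, so the normalised `B v`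
    -- admits a larger `t`.
    have hd : ∀ i, 0 < (B *ᵥ (B *ᵥ v - t • v)) i :=
      mulVec_pos_of_pos hB (fun i => sub_nonneg.2 (hvt i)) (sub_ne_zero.2 hne)
    set w := B *ᵥ v with hw_def
    have hd' : ∀ i, t * w i < (B *ᵥ w) i := by
      intro i
      have := hd i
      rw [Matrix.mulVec_sub, Matrix.mulVec_smul, ← hw_def] at this
      simpa using this
    obtain ⟨i1, hi1⟩ := Finite.exists_min fun i => (B *ᵥ w) i / w i
    set t' := (B *ᵥ w) i1 / w i1 with ht'
    have htt' : t < t' := (lt_div_iff₀ (hw i1)).2 (hd' i1)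
    have hS : 0 < ∑ i, w i := Finset.sum_pos (fun i _ => hw i) Finset.univ_nonempty
    set S := ∑ i, w i with hS_def
    have hmem : S⁻¹ • w ∈ stdSimplex ℝ ι := by
      refine ⟨fun i => mul_nonneg (inv_nonneg.2 hS.le) (hw i).le, ?_⟩
      simp only [Pi.smul_apply, smul_eq_mul, ← Finset.mul_sum]
      exact inv_mul_cancel₀ hS.ne'
    have hineq : ∀ i, t' * (S⁻¹ • w) i ≤ (B *ᵥ (S⁻¹ • w)) i := by
      intro i
      rw [Matrix.mulVec_smul, Pi.smul_apply, Pi.smul_apply, smul_eq_mul, smul_eq_mul,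
        mul_left_comm]
      exact mul_le_mul_of_nonneg_left ((le_div_iff₀ (hw i)).1 (hi1 i)) (inv_nonneg.2 hS.le)
    have hin : (S⁻¹ • w, t') ∈ K :=
      ⟨⟨hmem, ht.1.trans htt'.le, hbound _ hmem _ hineq⟩, hineq⟩
    exact absurd (hmax hin) (not_le.2 htt')
  rw [heq] at hw
  have ht0 : 0 < t := by
    obtain ⟨i0⟩ := ‹Nonempty ι›
    refine lt_of_le_of_ne ht.1 fun h0 => ?_
    simpa [← h0] using hw i0
  exact ⟨v, t, fun i => pos_of_mul_pos_right (hw i) ht0.le, ht0, heq⟩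

/-- With `s` the least ratio `z i / y i`, the vector `z - s y` is nonnegative and vanishes
somewhere. Were it nonzero, `B` would make that entry positive, though `B` only multiplies it by
`t`. -/
theorem eq_smul_of_mulVec_eq_smul [Nonempty ι] {B : Matrix ι ι ℝ} (hB : ∀ i j, 0 < B i j)
    {y z : ι → ℝ} {t : ℝ} (hy : ∀ i, 0 < y i) (hBy : B *ᵥ y = t • y)
    (hBz : B *ᵥ z = t • z) : ∃ s : ℝ, z = s • y := by
  obtain ⟨i, hi⟩ := Finite.exists_min fun i => z i / y i
  refine ⟨z i / y i, ?_⟩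
  by_contra hne
  have h1 := mulVec_pos_of_pos hB (v := z - (z i / y i) • y)
    (fun j => sub_nonneg.2 ((le_div_iff₀ (hy j)).1 (hi j))) (sub_ne_zero.2 hne) i
  rw [Matrix.mulVec_sub, Matrix.mulVec_smul, hBy, hBz] at h1
  have h2 : z i / y i * y i = z i := div_mul_cancel₀ _ (hy i).ne'
  simp only [Pi.sub_apply, Pi.smul_apply, smul_eq_mul] at h1
  rw [mul_left_comm, h2, sub_self] at h1
  exact lt_irrefl _ h1

theorem exists_pos_eigenvector_of_commute [Nonempty ι] [DecidableEq ι] {A B : Matrix ι ι ℝ}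
    (hB : ∀ i j, 0 < B i j) (hAB : A * B = B * A) :
    ∃ (y : ι → ℝ) (a : ℝ), (∀ i, 0 < y i) ∧ A *ᵥ y = a • y := by
  obtain ⟨y, t, hy, -, hBy⟩ := exists_pos_eigenvector_of_pos hB
  obtain ⟨a, ha⟩ := eq_smul_of_mulVec_eq_smul hB (z := A *ᵥ y) hy hBy
    (by rw [Matrix.mulVec_mulVec, ← hAB, ← Matrix.mulVec_mulVec, hBy, Matrix.mulVec_smul])
  exact ⟨y, a, hy, ha⟩

end Perron

/-! ### The positive eigenvector belongs to the spectral radius. -/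

section Eigenvalues

variable {n : ℕ} {A : Matrix (Fin n) (Fin n) ℝ}

theorem pow_mulVec_eq_smul {ι R : Type*} [Fintype ι] [DecidableEq ι] [CommRing R]
    {M : Matrix ι ι R} {z : ι → R} {μ : R} (hz : M *ᵥ z = μ • z) (k : ℕ) :
    (M ^ k) *ᵥ z = μ ^ k • z := by
  induction k with
  | zero => simp
  | succ k ih => rw [pow_succ, ← Matrix.mulVec_mulVec, hz, Matrix.mulVec_smul, ih, smul_smul,
      pow_succ']

theorem toComplex_mulVec_ofReal (y : Fin n → ℝ) :
    toComplex A *ᵥ (fun i => (y i : ℂ)) = fun i => ((A *ᵥ y) i : ℂ) := by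
  ext i
  simp [toComplex, Matrix.mulVec, dotProduct]

theorem sum_toComplex_pow_mul {z : Fin n → ℂ} {μ : ℂ} (hz : toComplex A *ᵥ z = μ • z) (k : ℕ)
    (i : Fin n) : ∑ j, ((A ^ k) i j : ℂ) * z j = μ ^ k * z i := by
  have := congrFun (pow_mulVec_eq_smul hz k) i
  rw [← toComplex_pow] at this
  exact this

theorem norm_pow_mul_norm_le {z : Fin n → ℂ} {μ : ℂ} (hz : toComplex A *ᵥ z = μ • z) {k : ℕ}
    (hk : ∀ i j, 0 ≤ (A ^ k) i j) (i : Fin n) :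
    ‖μ‖ ^ k * ‖z i‖ ≤ ∑ j, (A ^ k) i j * ‖z j‖ := by
  rw [← norm_pow, ← norm_mul, ← sum_toComplex_pow_mul hz k i]
  refine (norm_sum_le _ _).trans (Finset.sum_le_sum fun j _ => ?_)
  rw [norm_mul, Complex.norm_real, Real.norm_of_nonneg (hk i j)]

/-- Compare `|z|` with `y` at an index where `|z i| / y i` is largest. -/
theorem norm_pow_le_pow_of_pos_eigenvector {y : Fin n → ℝ} {a : ℝ} (hy : ∀ i, 0 < y i)
    (hAy : A *ᵥ y = a • y) {k : ℕ} (hk : ∀ i j, 0 ≤ (A ^ k) i j) {μ : ℂ}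
    (hμ : μ ∈ spectrum ℂ (toComplex A)) : ‖μ‖ ^ k ≤ a ^ k := by
  obtain ⟨z, hz0, hz⟩ := mem_spectrum_iff_exists_mulVec_eq.1 hμ
  obtain ⟨j, hj⟩ := Function.ne_iff.1 hz0
  have : Nonempty (Fin n) := ⟨j⟩
  obtain ⟨i, hi⟩ := Finite.exists_max fun i => ‖z i‖ / y i
  have hpos : 0 < ‖z i‖ / y i := (div_pos (norm_pos_iff.2 hj) (hy j)).trans_le (hi j)
  have hzi : 0 < ‖z i‖ := (div_pos_iff_of_pos_right (hy i)).1 hpos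
  have h1 := norm_pow_mul_norm_le hz hk i
  have h2 : ∑ j, (A ^ k) i j * ‖z j‖ ≤ ∑ j, ‖z i‖ / y i * ((A ^ k) i j * y j) := by
    refine Finset.sum_le_sum fun j _ => ?_
    rw [mul_left_comm]
    exact mul_le_mul_of_nonneg_left ((div_le_iff₀ (hy j)).1 (hi j)) (hk i j)
  have h3 : ∑ j, (A ^ k) i j * y j = a ^ k * y i := congrFun (pow_mulVec_eq_smul hAy k) i
  rw [← Finset.mul_sum, h3, mul_left_comm, div_mul_cancel₀ _ (hy i).ne'] at h2
  exact le_of_mul_le_mul_right (h1.trans h2) hzi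

theorem eigenvalue_eq_one [Nonempty (Fin n)] {p : ℕ} (hp : ∀ k, p ≤ k → ∀ i j, 0 ≤ (A ^ k) i j)
    (hρ : spectralRadius ℂ (toComplex A) = 1) {y : Fin n → ℝ} {a : ℝ} (hy : ∀ i, 0 < y i)
    (hAy : A *ᵥ y = a • y) : a = 1 := by
  obtain ⟨i⟩ := ‹Nonempty (Fin n)›
  have hpow : ∀ k, p ≤ k → 0 ≤ a ^ k := by
    intro k hk
    have h3 : ∑ j, (A ^ k) i j * y j = a ^ k * y i := congrFun (pow_mulVec_eq_smul hAy k) i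
    refine nonneg_of_mul_nonneg_left (b := y i) ?_ (hy i)
    rw [← h3]
    exact Finset.sum_nonneg fun j _ => mul_nonneg (hp k hk i j) (hy j).le
  -- An odd exponent beyond `p` excludes negative `a`.
  have ha : 0 ≤ a := by
    by_contra! hneg
    have h1 := hpow (2 * p + 1) (by omega)
    have : a ^ (2 * p + 1) < 0 := Odd.pow_neg ⟨p, rfl⟩ hneg
    exact absurd h1 (not_le.2 this)
  have hle : ∀ μ ∈ spectrum ℂ (toComplex A), ‖μ‖ ≤ a := fun μ hμ =>
    le_of_pow_le_pow_left₀ (Nat.succ_ne_zero p) ha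
      (norm_pow_le_pow_of_pos_eigenvector hy hAy (hp (p + 1) (by omega)) hμ)
  apply le_antisymm
  · have hmem : (a : ℂ) ∈ spectrum ℂ (toComplex A) := by
      refine mem_spectrum_iff_exists_mulVec_eq.2 ⟨fun i => (y i : ℂ), ?_, ?_⟩
      · exact Function.ne_iff.2 ⟨i, by simpa using (hy i).ne'⟩
      · rw [toComplex_mulVec_ofReal, hAy]
        ext j
        simp
    have h1 : (‖(a : ℂ)‖₊ : ENNReal) ≤ 1 := by
      rw [← hρ]
      exact le_iSup₂ (f := fun (μ : ℂ) (_ : μ ∈ spectrum ℂ (toComplex A)) => (‖μ‖₊ : ENNReal))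
        (a : ℂ) hmem
    have h2 : ‖(a : ℂ)‖ ≤ 1 := by exact_mod_cast h1
    rw [Complex.norm_real] at h2
    exact (le_abs_self a).trans h2
  · have h1 : (1 : ENNReal) ≤ ENNReal.ofReal a := by
      rw [← hρ]
      refine iSup₂_le fun μ hμ => ?_
      have := ENNReal.ofReal_le_ofReal (hle μ hμ)
      rwa [ofReal_norm] at this
    simpa using h1

end Eigenvalues

section Perron

variable {n : ℕ} {A : Matrix (Fin n) (Fin n) ℝ}

theorem EventuallyNonneg.hasPositiveEigenvectors [Nonempty (Fin n)] {p N : ℕ}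
    (hp : ∀ k, p ≤ k → ∀ i j, 0 ≤ (A ^ k) i j)
    (hN : ∀ i j, 0 < (∑ k ∈ Finset.Icc p N, A ^ k) i j)
    (hρ : spectralRadius ℂ (toComplex A) = 1) : HasPositiveEigenvectors A := by
  set B := ∑ k ∈ Finset.Icc p N, A ^ k with hB
  have hAB : A * B = B * A := by
    rw [hB, Finset.mul_sum, Finset.sum_mul]
    exact Finset.sum_congr rfl fun k _ => by rw [← pow_succ, ← pow_succ']
  obtain ⟨y, a, hy, hAy⟩ := exists_pos_eigenvector_of_commute hN hAB
  obtain ⟨x, b, hx, hAx⟩ := exists_pos_eigenvector_of_commute (A := Aᵀ) (B := Bᵀ)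
    (fun i j => hN j i) (by rw [← Matrix.transpose_mul, ← Matrix.transpose_mul, hAB])
  have ha := eigenvalue_eq_one hp hρ hy hAy
  rw [Matrix.mulVec_transpose] at hAx
  have hdot : 0 < x ⬝ᵥ y :=
    Finset.sum_pos (fun i _ => mul_pos (hx i) (hy i)) Finset.univ_nonempty
  -- Evaluating `xᵀ A y` from both sides shows that the left and right eigenvalues agree.
  have hb : b = 1 := by
    have h1 := Matrix.dotProduct_mulVec x A y
    rw [hAx, hAy, ha, one_smul, smul_dotProduct, smul_eq_mul] at h1
    exact mul_right_cancel₀ hdot.ne' (by rw [← h1, one_mul])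
  exact ⟨⟨x, hx, by rw [hAx, hb, one_smul]⟩, y, hy, by rw [hAy, ha, one_smul]⟩

/-- Cancellation: elements of index at most one are determined by their high powers. -/
theorem eq_of_pow_eq_pow {R : Type*} [Ring R] {a b w w' v g : R} {m : ℕ}
    (ha : a = a ^ m * w) (hb : b = b ^ m * w') (hb' : a = v * a ^ m)
    (hg : a ^ m = g * a ^ (m + 1))
    (hm : a ^ m = b ^ m) (hm' : a ^ (m + 1) = b ^ (m + 1)) : a = b := by
  -- Hence `a` annihilates `a - b`. But `a - b` is a left multiple by `a ^ m`, and there `hg` makes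
  -- left multiplication by `a` injective.
  have h1 : a * b = a * a := by
    calc a * b = v * a ^ m * b := by rw [← hb']
      _ = v * a ^ (m + 1) := by rw [hm', pow_succ, mul_assoc, hm]
      _ = a * a := by rw [pow_succ, ← mul_assoc, ← hb']
  have hd : a - b = a ^ m * (w - w') := by
    rw [mul_sub, ← ha, hm, ← hb]
  rw [← sub_eq_zero, hd, hg, pow_succ', mul_assoc, mul_assoc, ← hd, mul_sub, h1, sub_self,
    mul_zero]

end Perron

/-- Equality in the triangle inequality: after rotation by the conjugate of `σ`, real parts bounded
by moduli have the same weighted sum. -/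
theorem eq_norm_mul_of_norm_sum_eq {ι : Type*} [Fintype ι] {a : ι → ℝ} (ha : ∀ j, 0 ≤ a j)
    {z : ι → ℂ} {σ : ℂ} (hσ : ‖σ‖ = 1)
    (h : ∑ j, (a j : ℂ) * z j = σ * (∑ j, a j * ‖z j‖ : ℝ)) {j : ι} (hj : a j ≠ 0) :
    z j = σ * ‖z j‖ := by
  have hσσ : (starRingEnd ℂ σ) * σ = 1 := by
    rw [← Complex.normSq_eq_conj_mul_self, Complex.normSq_eq_norm_sq, hσ]
    simp
  have hle : ∀ k, ((starRingEnd ℂ σ) * z k).re ≤ ‖z k‖ := by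
    intro k
    have := Complex.re_le_norm ((starRingEnd ℂ σ) * z k)
    rwa [norm_mul, Complex.norm_conj, hσ, one_mul] at this
  have hsum : ∑ k, a k * ((starRingEnd ℂ σ) * z k).re = ∑ k, a k * ‖z k‖ := by
    have h1 := congrArg (fun w => ((starRingEnd ℂ σ) * w).re) h
    simp only [← mul_assoc, hσσ, one_mul, Complex.ofReal_re, Finset.mul_sum, Complex.re_sum] at h1
    rw [← h1]
    refine Finset.sum_congr rfl fun k _ => ?_
    rw [mul_comm _ (a k : ℂ), mul_assoc, Complex.re_ofReal_mul]
  have hterm := (Finset.sum_eq_sum_iff_of_le fun k _ =>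
    mul_le_mul_of_nonneg_left (hle k) (ha k)).1 hsum j (Finset.mem_univ j)
  have hre : ((starRingEnd ℂ σ) * z j).re = ‖(starRingEnd ℂ σ) * z j‖ := by
    rw [norm_mul, Complex.norm_conj, hσ, one_mul]
    exact mul_left_cancel₀ hj hterm
  have h2 : ((starRingEnd ℂ σ) * z j) = (‖(starRingEnd ℂ σ) * z j‖ : ℂ) := by
    rw [← hre]
    exact Complex.eq_re_of_ofReal_le (Complex.re_eq_norm.1 hre)
  rw [norm_mul, Complex.norm_conj, hσ, one_mul] at h2
  rw [← h2, ← mul_assoc, mul_comm σ, hσσ, one_mul]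

/-! ### Moduli and phases of peripheral eigenvectors. -/

section Peripheral

variable {n : ℕ} {A : Matrix (Fin n) (Fin n) ℝ} {p : ℕ}

/-- Entrywise `|z| ≤ A ^ k |z|`, and pairing with the positive left eigenvector `x` leaves no room
for strictness. -/
theorem pow_mulVec_norm_eq (hp : ∀ k, p ≤ k → ∀ i j, 0 ≤ (A ^ k) i j)
    {x : Fin n → ℝ} (hx : ∀ i, 0 < x i) (hxA : x ᵥ* A = x) {z : Fin n → ℂ} {μ : ℂ}
    (hμ : ‖μ‖ = 1) (hz : toComplex A *ᵥ z = μ • z) {k : ℕ} (hk : p ≤ k) :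
    (A ^ k) *ᵥ (fun i => ‖z i‖) = fun i => ‖z i‖ := by
  have hle : ∀ i, ‖z i‖ ≤ ((A ^ k) *ᵥ (fun i => ‖z i‖)) i := by
    intro i
    have := norm_pow_mul_norm_le hz (hp k hk) i
    rwa [hμ, one_pow, one_mul] at this
  have hsum : ∑ i, x i * ‖z i‖ = ∑ i, x i * ((A ^ k) *ᵥ (fun i => ‖z i‖)) i := by
    have := Matrix.dotProduct_mulVec x (A ^ k) (fun i => ‖z i‖)
    rw [vecMul_pow_eq hxA] at this
    exact this.symm
  have hterm := (Finset.sum_eq_sum_iff_of_le fun i _ =>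
    mul_le_mul_of_nonneg_left (hle i) (hx i).le).1 hsum
  ext i
  exact (mul_left_cancel₀ (hx i).ne' (hterm i (Finset.mem_univ i))).symm

/-- The moduli of a peripheral eigenvector form a multiple of the positive eigenvector. -/
theorem exists_norm_eq_mul {N : ℕ} (hp : ∀ k, p ≤ k → ∀ i j, 0 ≤ (A ^ k) i j)
    (hN : ∀ i j, 0 < (∑ k ∈ Finset.Icc p N, A ^ k) i j)
    {x : Fin n → ℝ} (hx : ∀ i, 0 < x i) (hxA : x ᵥ* A = x)
    {y : Fin n → ℝ} (hy : ∀ i, 0 < y i) (hyA : A *ᵥ y = y) {z : Fin n → ℂ} {μ : ℂ}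
    (hμ : ‖μ‖ = 1) (hz0 : z ≠ 0) (hz : toComplex A *ᵥ z = μ • z) :
    ∃ s : ℝ, 0 < s ∧ ∀ i, ‖z i‖ = s * y i := by
  obtain ⟨j, hj⟩ := Function.ne_iff.1 hz0
  have : Nonempty (Fin n) := ⟨j⟩
  have hsum : ∀ v : Fin n → ℝ, (∀ k, p ≤ k → (A ^ k) *ᵥ v = v) →
      (∑ k ∈ Finset.Icc p N, A ^ k) *ᵥ v = ((Finset.Icc p N).card : ℝ) • v := by
    intro v hv
    rw [Matrix.sum_mulVec, Finset.sum_congr rfl fun k hk => hv k (Finset.mem_Icc.1 hk).1,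
      Finset.sum_const, Nat.cast_smul_eq_nsmul]
  obtain ⟨s, hs⟩ := eq_smul_of_mulVec_eq_smul hN (z := fun i => ‖z i‖) hy
    (hsum y fun k _ => pow_mulVec_eq hyA k)
    (hsum _ fun k hk => pow_mulVec_norm_eq hp hx hxA hμ hz hk)
  have hs' : ∀ i, ‖z i‖ = s * y i := fun i => congrFun hs i
  refine ⟨s, ?_, hs'⟩
  have h1 : 0 < s * y j := by
    rw [← hs' j]
    exact norm_pos_iff.2 hj
  exact pos_of_mul_pos_left h1 (hy j).le

theorem phase_pow {N : ℕ} (hp : ∀ k, p ≤ k → ∀ i j, 0 ≤ (A ^ k) i j)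
    (hN : ∀ i j, 0 < (∑ k ∈ Finset.Icc p N, A ^ k) i j)
    {x : Fin n → ℝ} (hx : ∀ i, 0 < x i) (hxA : x ᵥ* A = x)
    {y : Fin n → ℝ} (hy : ∀ i, 0 < y i) (hyA : A *ᵥ y = y) {z : Fin n → ℂ} {μ : ℂ}
    (hμ : ‖μ‖ = 1) (hz0 : z ≠ 0) (hz : toComplex A *ᵥ z = μ • z) {k : ℕ} (hk : p ≤ k)
    {i j : Fin n} (hij : (A ^ k) i j ≠ 0) : z j / y j = μ ^ k * (z i / y i) := by
  obtain ⟨s, hs, hzs⟩ := exists_norm_eq_mul hp hN hx hxA hy hyA hμ hz0 hz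
  have hpos : ∀ i, 0 < ‖z i‖ := fun i => by rw [hzs]; exact mul_pos hs (hy i)
  have hc : ∀ i, (‖z i‖ : ℂ) ≠ 0 := fun i => by exact_mod_cast (hpos i).ne'
  have hyc : ∀ i, (y i : ℂ) ≠ 0 := fun i => by exact_mod_cast (hy i).ne'
  have hsc : (s : ℂ) ≠ 0 := by exact_mod_cast hs.ne'
  have h1 : z j = (μ ^ k * (z i / ‖z i‖)) * ‖z j‖ := by
    refine eq_norm_mul_of_norm_sum_eq (hp k hk i) ?_ ?_ hij
    · rw [norm_mul, norm_pow, hμ, one_pow, one_mul, norm_div, Complex.norm_real, norm_norm,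
        div_self (hpos i).ne']
    · have h2 : ∑ j, (A ^ k) i j * ‖z j‖ = ‖z i‖ :=
        congrFun (pow_mulVec_norm_eq hp hx hxA hμ hz hk) i
      rw [h2, sum_toComplex_pow_mul hz k i, mul_assoc, div_mul_cancel₀ _ (hc i)]
  rw [hzs i, hzs j] at h1
  push_cast at h1
  have := hyc i
  have := hyc j
  rw [h1]
  field_simp

theorem conj_diagonal_pow {u : Fin n → ℂ} (hu : ∀ i, u i ≠ 0) (ν : ℂ)
    (M : Matrix (Fin n) (Fin n) ℂ) (k : ℕ) :
    (Matrix.of fun i j => ν * (u i)⁻¹ * M i j * u j : Matrix (Fin n) (Fin n) ℂ) ^ k =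
      Matrix.of fun i j => ν ^ k * (u i)⁻¹ * (M ^ k) i j * u j := by
  induction k with
  | zero =>
    ext i j
    by_cases h : i = j
    · subst h
      simp [hu i]
    · simp [h]
  | succ k ih =>
    rw [pow_succ, ih]
    ext i j
    simp only [Matrix.mul_apply, Matrix.of_apply, pow_succ, Finset.mul_sum, Finset.sum_mul]
    refine Finset.sum_congr rfl fun l _ => ?_
    have := hu l
    have := hu i
    field_simp

theorem conj_diagonal_mul {u : Fin n → ℂ} (hu : ∀ i, u i ≠ 0) (ν ν' : ℂ)
    (M M' : Matrix (Fin n) (Fin n) ℂ) :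
    (Matrix.of fun i j => ν * (u i)⁻¹ * M i j * u j : Matrix (Fin n) (Fin n) ℂ) *
      (Matrix.of fun i j => ν' * (u i)⁻¹ * M' i j * u j) =
      Matrix.of fun i j => (ν * ν') * (u i)⁻¹ * (M * M') i j * u j := by
  ext i j
  simp only [Matrix.mul_apply, Matrix.of_apply, Finset.mul_sum, Finset.sum_mul]
  refine Finset.sum_congr rfl fun l _ => ?_
  have := hu l
  have := hu i
  field_simp

open Polynomial in
/-- A phase relation on the arcs of all high powers holds on the arcs of the matrix itself. -/
theorem phase_of_phase_pow (hr : (A ^ 2).rank = A.rank) {u : Fin n → ℂ} (hu : ∀ i, u i ≠ 0)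
    {μ : ℂ} (hμ : μ ≠ 0)
    (h : ∀ k, p ≤ k → ∀ i j, (A ^ k) i j ≠ 0 → u j = μ ^ k * u i) {i j : Fin n}
    (hij : A i j ≠ 0) : u j = μ * u i := by
  obtain ⟨g, hg⟩ := exists_aeval_of_rank_sq_eq hr
  set G := aeval A g with hG
  have hcomm : A * G = G * A := by
    have h1 : aeval A (X * g) = A * G := by rw [map_mul, aeval_X]
    rw [← h1, mul_comm, map_mul, aeval_X]
  have hit := eq_pow_mul_aeval_pow hg (p + 1)
  rw [← hG] at hit
  have hGA : A = G ^ (p + 1) * A * A ^ (p + 1) := by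
    have hc : Commute (A ^ (p + 1 + 1)) (G ^ (p + 1)) := (Commute.pow_pow hcomm _ _)
    rw [mul_assoc, ← pow_succ', ← hc.eq]
    exact hit
  have hpow : A ^ (p + 1) = G * A ^ (p + 1 + 1) := by
    have h1 : A = G * A ^ 2 := by
      have hc : Commute (A ^ 2) G := Commute.pow_left hcomm 2
      rw [← hc.eq]
      exact hg
    calc A ^ (p + 1) = A * A ^ p := pow_succ' A p
      _ = G * A ^ 2 * A ^ p := by rw [← h1]
      _ = G * A ^ (p + 1 + 1) := by rw [mul_assoc, ← pow_add, add_comm 2 p]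
  rw [pow_succ, mul_assoc] at hit
  set a := toComplex A with ha
  -- With `D = diag u`, `b = μ⁻¹ D⁻¹ a D`; the claim amounts to `a = b`, and the hypothesis says
  -- that their high powers agree. The factor `μ ^ p` in `w` leaves `μ⁻¹` after multiplication by `b
  -- ^ (p + 1)`.
  set b : Matrix (Fin n) (Fin n) ℂ := Matrix.of fun i j => μ⁻¹ * (u i)⁻¹ * a i j * u j with hb
  set w : Matrix (Fin n) (Fin n) ℂ :=
    Matrix.of fun i j => μ ^ p * (u i)⁻¹ * (toComplex (A * G ^ (p + 1))) i j * u j with hw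
  have hpe : ∀ k, p ≤ k → a ^ k = b ^ k := by
    intro k hk
    rw [hb, conj_diagonal_pow hu, ha, ← toComplex_pow]
    ext i j
    by_cases h0 : (A ^ k) i j = 0
    · simp [toComplex, h0]
    · have := hu i
      simp only [Matrix.of_apply, h k hk i j h0, inv_pow]
      field_simp
  have hbw : b = b ^ (p + 1) * w := by
    rw [hb, conj_diagonal_pow hu, hw, conj_diagonal_mul hu, ha, ← toComplex_pow, ← toComplex_mul,
      ← hit]
    ext i j
    simp only [Matrix.of_apply, inv_pow]
    congr 3
    rw [pow_succ]
    field_simp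
  have hab : a = b := by
    refine eq_of_pow_eq_pow (m := p + 1) (w := toComplex (A * G ^ (p + 1))) (w' := w)
      (v := toComplex (G ^ (p + 1) * A)) (g := toComplex G) ?_ hbw ?_ ?_
      (hpe _ (by omega)) (hpe _ (by omega))
    · rw [ha, ← toComplex_pow, ← toComplex_mul, ← hit]
    · rw [ha, ← toComplex_pow, ← toComplex_mul, ← hGA]
    · rw [ha, ← toComplex_pow, ← toComplex_pow, ← toComplex_mul, ← hpow]
  have h1 := congrFun (congrFun hab i) j
  have h2 : a i j ≠ 0 := by
    rw [ha]
    simpa [toComplex] using hij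
  have h3 := hu i
  rw [hb, Matrix.of_apply] at h1
  field_simp at h1
  exact h1.symm

end Peripheral

/-! ### Arc multipliers and the index of cyclicity. -/

section Cyclicity

variable {n h : ℕ} {A : Matrix (Fin n) (Fin n) ℝ}

/-- The multipliers `μ` for which there is a nowhere vanishing function that is multiplied by `μ`
along every arc of the digraph of `A`. -/
def arcMultipliers (A : Matrix (Fin n) (Fin n) ℝ) : Submonoid ℂ where
  carrier := {μ | ∃ u : Fin n → ℂ, (∀ i, u i ≠ 0) ∧ ∀ i j, A i j ≠ 0 → u j = μ * u i}
  one_mem' := ⟨fun _ => 1, fun _ => one_ne_zero, fun _ _ _ => (one_mul _).symm⟩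
  mul_mem' := by
    rintro μ ν ⟨u, hu, hu'⟩ ⟨v, hv, hv'⟩
    refine ⟨fun i => u i * v i, fun i => mul_ne_zero (hu i) (hv i), fun i j hij => ?_⟩
    simp only [hu' i j hij, hv' i j hij]
    ring

theorem IsIrreducible.exists_eq_pow_mul (hA : IsIrreducible A) {u : Fin n → ℂ} {μ : ℂ}
    (hu : ∀ i j, A i j ≠ 0 → u j = μ * u i) (i j : Fin n) : ∃ m : ℕ, u j = μ ^ m * u i := by
  refine hA.mem_of_closed {j | ∃ m : ℕ, u j = μ ^ m * u i} ⟨i, 0, by simp⟩ ?_ j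
  rintro a b ⟨m, hm⟩ hab
  exact ⟨m + 1, by rw [hu a b hab, hm, pow_succ', mul_assoc]⟩

theorem IsIrreducible.orderOf_pos_of_mem_arcMultipliers (hA : IsIrreducible A) (hn : 1 < n)
    {μ : ℂ} (hμ : μ ∈ arcMultipliers A) : 0 < orderOf μ := by
  obtain ⟨u, hu0, hu⟩ := hμ
  obtain ⟨j, hj⟩ := hA.exists_ne_zero hn ⟨0, by omega⟩
  -- A path back to the start closes a walk of length `m + 1`, so `μ ^ (m + 1) = 1`.
  obtain ⟨m, hm⟩ := hA.exists_eq_pow_mul hu j ⟨0, by omega⟩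
  refine orderOf_pos_iff.2 (isOfFinOrder_iff_pow_eq_one.2 ⟨m + 1, m.succ_pos, ?_⟩)
  rw [hu _ _ hj, ← mul_assoc, ← pow_succ] at hm
  exact (mul_eq_right₀ (hu0 _)).1 hm.symm

/-- Relative to a base vertex, `u` takes values that are powers of `μ`; the exponent modulo the
order of `μ` is the class. All classes occur because every vertex has an outgoing arc. -/
theorem IsIrreducible.isCyclic_orderOf (hA : IsIrreducible A) (hn : 1 < n)
    {μ : ℂ} (hμ : μ ∈ arcMultipliers A) (h2 : 2 ≤ orderOf μ) : IsCyclic A (orderOf μ) := by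
  obtain ⟨u, hu0, hu⟩ := hμ
  let i0 : Fin n := ⟨0, by omega⟩
  have : NeZero (orderOf μ) := ⟨by omega⟩
  have hμ0 : μ ≠ 0 := by
    rintro rfl
    obtain ⟨j, hj⟩ := hA.exists_ne_zero hn i0
    exact hu0 j (by rw [hu _ _ hj, zero_mul])
  choose m hm using hA.exists_eq_pow_mul hu i0
  have hpow : ∀ a b : ℕ, μ ^ a = μ ^ b → (a : ZMod (orderOf μ)) = b := by
    intro a b hab
    rw [ZMod.natCast_eq_natCast_iff]
    have h1 : Units.mk0 μ hμ0 ^ a = Units.mk0 μ hμ0 ^ b := Units.ext (by simpa using hab)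
    have h3 := pow_eq_pow_iff_modEq.1 h1
    rwa [← orderOf_units, Units.val_mk0] at h3
  refine ⟨h2, fun j => (m j : ZMod (orderOf μ)), ?_, ?_⟩
  · have hex : ∀ k : ℕ, ∃ j, u j = μ ^ k * u i0 := by
      intro k
      induction k with
      | zero => exact ⟨i0, by simp⟩
      | succ k ih =>
        obtain ⟨j, hj⟩ := ih
        obtain ⟨l, hl⟩ := hA.exists_ne_zero hn j
        exact ⟨l, by rw [hu _ _ hl, hj, pow_succ', mul_assoc]⟩
    intro l
    obtain ⟨j, hj⟩ := hex l.val
    refine ⟨j, ?_⟩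
    have := hpow (m j) l.val (mul_right_cancel₀ (hu0 i0) (by rw [← hm j, hj]))
    simpa using this
  · intro i j hij
    have := hpow (m j) (m i + 1) (mul_right_cancel₀ (hu0 i0)
      (by rw [← hm j, hu i j hij, hm i, pow_succ', mul_assoc]))
    simpa using this

theorem DescribesCyclic.stdAddChar_arc [NeZero h] {c : Fin n → ZMod h}
    (hc : DescribesCyclic A h c) (l : ZMod h) {i j : Fin n} (hij : A i j ≠ 0) :
    ZMod.stdAddChar (l * c j) = ZMod.stdAddChar l * ZMod.stdAddChar (l * c i) := by
  rw [hc.2 i j hij, mul_add, mul_one, AddChar.map_add_eq_mul, mul_comm]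

theorem stdAddChar_ne_zero [NeZero h] (l : ZMod h) : ZMod.stdAddChar l ≠ 0 := by
  rw [ZMod.stdAddChar_apply]
  exact Circle.coe_ne_zero _

theorem stdAddChar_natCast [NeZero h] (k : ℕ) :
    ZMod.stdAddChar (k : ZMod h) = Complex.exp (2 * Real.pi * Complex.I / h) ^ k := by
  have := ZMod.stdAddChar_coe (N := h) (k : ℤ)
  rw [Int.cast_natCast] at this
  rw [this, ← Complex.exp_nat_mul]
  congr 1
  push_cast
  ring

theorem DescribesCyclic.stdAddChar_mem [NeZero h] {c : Fin n → ZMod h}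
    (hc : DescribesCyclic A h c) (l : ZMod h) : ZMod.stdAddChar l ∈ arcMultipliers A :=
  ⟨fun i => ZMod.stdAddChar (l * c i), fun _ => stdAddChar_ne_zero _,
    fun _ _ hij => hc.stdAddChar_arc l hij⟩

/-- `ω` and `μ` generate a multiplier whose order is the least common multiple of `h` and the order
of `μ`. Maximality of `h` bounds it by `h`, so the order of `μ` divides `h`. -/
theorem IsIrreducible.pow_eq_one_of_mem_arcMultipliers (hA : IsIrreducible A) (hn : 1 < n)
    (hc : HasCyclicIndex A h) {μ : ℂ} (hμ : μ ∈ arcMultipliers A) : μ ^ h = 1 := by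
  obtain ⟨⟨h2, c, hcc⟩, hmax⟩ := hc
  have : NeZero h := ⟨by omega⟩
  set ω : ℂ := Complex.exp (2 * Real.pi * Complex.I / h) with hω
  have hωo : orderOf ω = h := (Complex.isPrimitiveRoot_exp h (NeZero.ne h)).eq_orderOf.symm
  have hωm : ω ∈ arcMultipliers A := by
    have := hcc.stdAddChar_mem ((1 : ℕ) : ZMod h)
    rwa [stdAddChar_natCast, pow_one] at this
  obtain ⟨z, hz, hzo⟩ := Commute.exists_orderOf_eq_lcm ℂ (Commute.all ω μ)
  have hzm : z ∈ arcMultipliers A := by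
    refine (Submonoid.closure_le (S := arcMultipliers A)).2 ?_ hz
    rintro a (rfl | rfl)
    · exact hωm
    · exact hμ
  have hz0 := hA.orderOf_pos_of_mem_arcMultipliers hn hzm
  rw [hωo] at hzo
  have hhz : h ∣ orderOf z := hzo ▸ Nat.dvd_lcm_left _ _
  have hle : orderOf z ≤ h :=
    hmax (hA.isCyclic_orderOf hn hzm (h2.trans (Nat.le_of_dvd hz0 hhz)))
  have heq : orderOf z = h := le_antisymm hle (Nat.le_of_dvd hz0 hhz)
  apply orderOf_dvd_iff_pow_eq_one.1
  rw [← heq, hzo]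
  exact Nat.dvd_lcm_right _ _

theorem IsIrreducible.exists_eq_mul_of_arcs (hA : IsIrreducible A) {u v : Fin n → ℂ} {μ : ℂ}
    (hμ : μ ≠ 0) (hu : ∀ i j, A i j ≠ 0 → u j = μ * u i) (hv0 : ∀ i, v i ≠ 0)
    (hv : ∀ i j, A i j ≠ 0 → v j = μ * v i) : ∃ α : ℂ, ∀ i, u i = α * v i := by
  rcases n with _ | n
  · exact ⟨0, fun i => i.elim0⟩
  refine ⟨u 0 / v 0, fun i => ?_⟩
  have h1 : u i / v i = u 0 / v 0 := by
    refine hA.mem_of_closed {i | u i / v i = u 0 / v 0} ⟨0, rfl⟩ (fun i j hi hij => ?_) i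
    change u j / v j = _
    rw [hu i j hij, hv i j hij, mul_div_mul_left _ _ hμ]
    exact hi
  rw [← h1, div_mul_cancel₀ _ (hv0 i)]

end Cyclicity

/-! ### Class sums, whose kernel is the invariant complement. -/

section ClassSum

variable {n h : ℕ} {A : Matrix (Fin n) (Fin n) ℝ} {c : Fin n → ZMod h}

/-- The class sums of `z` weighted by `x`. -/
noncomputable def classSum (c : Fin n → ZMod h) (x : Fin n → ℝ) :
    (Fin n → ℂ) →ₗ[ℂ] (ZMod h → ℂ) where
  toFun z l := ∑ j, if c j = l then (x j : ℂ) * z j else 0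
  map_add' z w := by
    ext l
    simp only [Pi.add_apply, ← Finset.sum_add_distrib]
    refine Finset.sum_congr rfl fun j _ => ?_
    split_ifs <;> ring
  map_smul' a z := by
    ext l
    simp only [Pi.smul_apply, smul_eq_mul, Finset.mul_sum, RingHom.id_apply]
    refine Finset.sum_congr rfl fun j _ => ?_
    split_ifs <;> ring

/-- The class sums intertwine `A` with the cyclic shift, so their kernel is invariant under `A`. -/
theorem classSum_mulVec (hc : DescribesCyclic A h c) {x : Fin n → ℝ} (hxA : x ᵥ* A = x)
    (z : Fin n → ℂ) (l : ZMod h) :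
    classSum c x (toComplex A *ᵥ z) l = classSum c x z (l + 1) := by
  have h1 : ∀ m, ∑ j, (x j : ℂ) * A j m = x m := by
    intro m
    have : ∑ j, x j * A j m = x m := congrFun hxA m
    exact_mod_cast this
  change ∑ j, (if c j = l then (x j : ℂ) * ∑ m, (A j m : ℂ) * z m else 0) =
    ∑ m, if c m = l + 1 then (x m : ℂ) * z m else 0
  have h2 : ∀ j, (if c j = l then (x j : ℂ) * ∑ m, (A j m : ℂ) * z m else 0) =
      ∑ m, (if c m = l + 1 then (x j : ℂ) * A j m * z m else 0) := by
    intro j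
    split_ifs with hj
    · rw [Finset.mul_sum]
      refine Finset.sum_congr rfl fun m _ => ?_
      by_cases hjm : A j m = 0
      · simp [hjm]
      · rw [if_pos (by rw [hc.2 j m hjm, hj]), mul_assoc]
    · refine (Finset.sum_eq_zero fun m _ => ?_).symm
      by_cases hjm : A j m = 0
      · simp [hjm]
      · rw [if_neg]
        rw [hc.2 j m hjm, add_left_inj]
        exact hj
  rw [Finset.sum_congr rfl fun j _ => h2 j, Finset.sum_comm]
  refine Finset.sum_congr rfl fun m _ => ?_
  split_ifs
  · rw [← Finset.sum_mul, h1]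
  · simp

/-- The factors `classDot` are nonzero for positive `x`, `y`, so the span of the vectors `cyclicVec`
meets the kernel trivially. -/
theorem classSum_class_mul (x y : Fin n → ℝ) (g : ZMod h → ℂ) (m : ZMod h) :
    classSum c x (fun i => g (c i) * y i) m = g m * classDot c x y m := by
  change ∑ j, (if c j = m then (x j : ℂ) * (g (c j) * y j) else 0) = _
  rw [classDot, Complex.ofReal_sum, Finset.mul_sum]
  refine Finset.sum_congr rfl fun j _ => ?_
  split_ifs with hj
  · rw [hj]
    push_cast
    ring
  · simp

end ClassSum

/-! ### Determination of the peripheral eigenvectors. -/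

section Peripheral

variable {n h : ℕ} [NeZero h] {A : Matrix (Fin n) (Fin n) ℝ} {c : Fin n → ZMod h}

/-- The eigenvector of `A` for the eigenvalue `exp (2πi/h) ^ l` made from a positive one. -/
noncomputable def cyclicVec (c : Fin n → ZMod h) (y : Fin n → ℝ) (l : ZMod h) : Fin n → ℂ :=
  fun i => ZMod.stdAddChar (l * c i) * y i

theorem DescribesCyclic.mulVec_cyclicVec (hc : DescribesCyclic A h c) {y : Fin n → ℝ}
    (hyA : A *ᵥ y = y) (l : ZMod h) :
    toComplex A *ᵥ cyclicVec c y l = ZMod.stdAddChar l • cyclicVec c y l := by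
  ext i
  have h1 : ∀ j, (A i j : ℂ) * cyclicVec c y l j =
      ZMod.stdAddChar l * ZMod.stdAddChar (l * c i) * (A i j * y j : ℝ) := by
    intro j
    by_cases hij : A i j = 0
    · simp [hij]
    · rw [cyclicVec, hc.stdAddChar_arc l hij]
      push_cast
      ring
  have h2 : ∑ j, A i j * y j = y i := congrFun hyA i
  change ∑ j, (A i j : ℂ) * cyclicVec c y l j = _
  rw [Finset.sum_congr rfl fun j _ => h1 j, ← Finset.mul_sum, ← Complex.ofReal_sum, h2]
  simp [cyclicVec, mul_assoc]

/-- All peripheral eigenvectors of `A` are multiples of the vectors `cyclicVec`. -/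
theorem exists_eq_smul_cyclicVec {p N : ℕ} (hA : IsIrreducible A) (hn : 1 < n)
    (hr : (A ^ 2).rank = A.rank)
    (hh : HasCyclicIndex A h) (hc : DescribesCyclic A h c)
    (hp : ∀ k, p ≤ k → ∀ i j, 0 ≤ (A ^ k) i j)
    (hN : ∀ i j, 0 < (∑ k ∈ Finset.Icc p N, A ^ k) i j)
    {x : Fin n → ℝ} (hx : ∀ i, 0 < x i) (hxA : x ᵥ* A = x)
    {y : Fin n → ℝ} (hy : ∀ i, 0 < y i) (hyA : A *ᵥ y = y) {z : Fin n → ℂ} {μ : ℂ}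
    (hμ : ‖μ‖ = 1) (hz0 : z ≠ 0) (hz : toComplex A *ᵥ z = μ • z) :
    ∃ (α : ℂ) (l : ZMod h), z = α • cyclicVec c y l := by
  have hμ0 : μ ≠ 0 := by
    rintro rfl
    simp at hμ
  obtain ⟨s, hs, hzs⟩ := exists_norm_eq_mul hp hN hx hxA hy hyA hμ hz0 hz
  have hyc : ∀ i, (y i : ℂ) ≠ 0 := fun i => by exact_mod_cast (hy i).ne'
  have hu0 : ∀ i, z i / y i ≠ 0 := fun i => by
    refine div_ne_zero (norm_pos_iff.1 ?_) (hyc i)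
    rw [hzs]
    exact mul_pos hs (hy i)
  have hu : ∀ i j, A i j ≠ 0 → z j / y j = μ * (z i / y i) := fun i j hij =>
    phase_of_phase_pow (u := fun i => z i / y i) hr hu0 hμ0
      (fun k hk i j hij => phase_pow hp hN hx hxA hy hyA hμ hz0 hz hk hij) hij
  have hμh := hA.pow_eq_one_of_mem_arcMultipliers hn hh ⟨_, hu0, hu⟩
  obtain ⟨k, -, hk⟩ := (Complex.isPrimitiveRoot_exp h (NeZero.ne h)).eq_pow_of_pow_eq_one hμh
  have hl : μ = ZMod.stdAddChar (k : ZMod h) := by rw [stdAddChar_natCast, hk]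
  obtain ⟨α, hα⟩ := hA.exists_eq_mul_of_arcs hμ0 hu
    (v := fun i => ZMod.stdAddChar ((k : ZMod h) * c i)) (fun i => stdAddChar_ne_zero _)
    (fun i j hij => by rw [hl]; exact hc.stdAddChar_arc (k : ZMod h) hij)
  refine ⟨α, k, ?_⟩
  ext i
  rw [Pi.smul_apply, smul_eq_mul, cyclicVec, ← mul_assoc, ← hα i, div_mul_cancel₀ _ (hyc i)]

theorem linearIndependent_cyclicVec (hc : DescribesCyclic A h c) {y : Fin n → ℝ}
    (hy : ∀ i, 0 < y i) (hyA : A *ᵥ y = y) :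
    LinearIndependent ℂ (cyclicVec c y) := by
  refine Module.End.eigenvectors_linearIndependent' (Matrix.toLin' (toComplex A))
    (fun l => ZMod.stdAddChar l) ZMod.injective_stdAddChar _ fun l => ?_
  refine ⟨Module.End.mem_eigenspace_iff.2 ?_, ?_⟩
  · rw [Matrix.toLin'_apply, hc.mulVec_cyclicVec hyA]
  · obtain ⟨i, -⟩ := hc.1 0
    refine Function.ne_iff.2 ⟨i, mul_ne_zero (stdAddChar_ne_zero _) ?_⟩
    exact_mod_cast (hy i).ne'

end Peripheral

/-! ### Assembly of the Jordan form in (C). -/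

theorem sum_jordanMatrix_smul {V : Type*} [AddCommGroup V] [Module ℂ V] {t : ℕ} (r : Fin t → ℕ)
    (μ : Fin t → ℂ) (b : (Σ s : Fin t, Fin (r s)) → V) (s : Fin t) (j : Fin (r s)) :
    ∑ a, jordanMatrix r μ a ⟨s, j⟩ • b a = ∑ i, jordanBlock (r s) (μ s) i j • b ⟨s, i⟩ := by
  rw [Fintype.sum_sigma, Finset.sum_eq_single s]
  · simp [jordanMatrix]
  · intro s' _ hs'
    refine Finset.sum_eq_zero fun i _ => ?_
    rw [jordanMatrix, Matrix.blockDiagonal'_apply_ne _ _ _ hs', zero_smul]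
  · simp

theorem spectralRadius_lt_one_of_forall {ι : Type*} [Fintype ι] [DecidableEq ι] {J : Matrix ι ι ℂ}
    (hJ : ∀ μ ∈ spectrum ℂ J, ‖μ‖ < 1) : spectralRadius ℂ J < 1 := by
  let _ : NormedRing (Matrix ι ι ℂ) := Matrix.linftyOpNormedRing
  let _ : NormedAlgebra ℂ (Matrix ι ι ℂ) := Matrix.linftyOpNormedAlgebra
  have : CompleteSpace (Matrix ι ι ℂ) := FiniteDimensional.complete ℂ _
  -- An empty `Ĵ` has empty spectrum and spectral radius zero.
  rcases (spectrum ℂ J).eq_empty_or_nonempty with h | h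
  · simp [spectralRadius, h]
  · exact_mod_cast spectrum.spectralRadius_lt_of_forall_lt_of_nonempty h (r := 1) hJ

variable {n h : ℕ} {A : Matrix (Fin n) (Fin n) ℝ} {c : Fin n → ZMod h}

theorem hasCyclicJordanForm_of_basis {t : ℕ} {r : Fin t → ℕ} {μ : Fin t → ℂ}
    (hr : ∀ s, 0 < r s) (v : Fin h ⊕ (Σ s : Fin t, Fin (r s)) → Fin n → ℂ)
    (hv : LinearIndependent ℂ v) (hcard : h + Fintype.card (Σ s : Fin t, Fin (r s)) = n)
    (hAl : ∀ k : Fin h, toComplex A *ᵥ v (Sum.inl k) =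
      Complex.exp (2 * Real.pi * Complex.I / h) ^ (k : ℕ) • v (Sum.inl k))
    (hAr : ∀ b, toComplex A *ᵥ v (Sum.inr b) = ∑ a, jordanMatrix r μ a b • v (Sum.inr a))
    (hρ : spectralRadius ℂ (jordanMatrix r μ) < 1) : HasCyclicJordanForm A h := by
  have hcard' : Fintype.card (Fin n) = Fintype.card (Fin h ⊕ (Σ s : Fin t, Fin (r s))) := by
    rw [Fintype.card_sum, Fintype.card_fin, Fintype.card_fin, hcard]
  let e := Fintype.equivOfCardEq hcard'
  let Z : Matrix (Fin n) (Fin n) ℂ := Matrix.of fun i j => v (e j) i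
  have hZ : IsUnit Z := by
    rw [← Matrix.linearIndependent_cols_iff_isUnit]
    exact hv.comp e e.injective
  set N := Matrix.fromBlocks (cyclicDiagonal h) 0 0 (jordanMatrix r μ) with hN
  have hAv : ∀ b, toComplex A *ᵥ v b = ∑ a, N a b • v a := by
    rintro (k | b)
    · rw [hAl, Fintype.sum_sum_type, Finset.sum_eq_single k]
      · simp [hN, cyclicDiagonal]
      · intro k' _ hk'
        simp [hN, cyclicDiagonal, hk']
      · simp
    · rw [hAr, Fintype.sum_sum_type]
      simp [hN]
  have hAZ : toComplex A * Z = Z * N.submatrix e e := by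
    ext i j
    have h1 := congrFun (hAv (e j)) i
    rw [← Equiv.sum_comp e, Finset.sum_apply] at h1
    rw [Matrix.mul_apply, Matrix.mul_apply]
    refine Eq.trans h1 (Finset.sum_congr rfl fun a _ => ?_)
    simp [Z, mul_comm]
  refine ⟨t, r, μ, e, Z, hr, hZ, ?_, hρ⟩
  rw [Matrix.mul_assoc, hAZ, ← Matrix.mul_assoc,
    Matrix.nonsing_inv_mul Z ((Matrix.isUnit_iff_isUnit_det Z).1 hZ), Matrix.one_mul]

theorem hasCyclicJordanForm_of_pow_nonneg [NeZero h] {p N : ℕ} (hA : IsIrreducible A) (hn : 1 < n)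
    (hr : (A ^ 2).rank = A.rank)
    (hh : HasCyclicIndex A h) (hc : DescribesCyclic A h c)
    (hp : ∀ k, p ≤ k → ∀ i j, 0 ≤ (A ^ k) i j)
    (hN : ∀ i j, 0 < (∑ k ∈ Finset.Icc p N, A ^ k) i j)
    {x : Fin n → ℝ} (hx : ∀ i, 0 < x i) (hxA : x ᵥ* A = x)
    {y : Fin n → ℝ} (hy : ∀ i, 0 < y i) (hyA : A *ᵥ y = y) : HasCyclicJordanForm A h := by
  set K := LinearMap.ker (classSum c x) with hK
  set f := Matrix.toLin' (toComplex A) with hf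
  have hKf : ∀ z ∈ K, f z ∈ K := by
    intro z hz
    rw [hK, LinearMap.mem_ker] at hz ⊢
    ext l
    rw [hf, Matrix.toLin'_apply, classSum_mulVec hc hxA, hz]
    rfl
  obtain ⟨t, r, μ, b, hr0, hb⟩ := exists_jordan_basis (f.restrict hKf)
  have hdot : ∀ m, (classDot c x y m : ℂ) ≠ 0 := fun m => by
    exact_mod_cast (classDot_pos hc.1 hx hy m).ne'
  have hbJ : ∀ a, toComplex A *ᵥ (b a : Fin n → ℂ) =
      ∑ a', jordanMatrix r μ a' a • (b a' : Fin n → ℂ) := by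
    rintro ⟨s, j⟩
    rw [sum_jordanMatrix_smul r μ (fun a => (b a : Fin n → ℂ))]
    have := congrArg Subtype.val (hb s j)
    rw [LinearMap.coe_restrict_apply, hf, Matrix.toLin'_apply] at this
    rw [this]
    simp
  have hρ : spectralRadius ℂ (jordanMatrix r μ) < 1 := by
    apply spectralRadius_lt_one_of_forall
    intro ν hν
    obtain ⟨w, hw0, hw⟩ := mem_spectrum_iff_exists_mulVec_eq.1 hν
    set z : K := ∑ a, w a • b a with hz
    have hz0 : (z : Fin n → ℂ) ≠ 0 := by
      intro h0
      apply hw0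
      ext a
      exact (Fintype.linearIndependent_iff.1 b.linearIndependent) w (Subtype.ext h0) a
    have hzA : toComplex A *ᵥ (z : Fin n → ℂ) = ν • (z : Fin n → ℂ) := by
      have h1 : (z : Fin n → ℂ) = ∑ a, w a • (b a : Fin n → ℂ) := by simp [hz]
      rw [h1, Matrix.mulVec_sum]
      simp only [Matrix.mulVec_smul, hbJ, Finset.smul_sum]
      rw [Finset.sum_comm]
      refine Finset.sum_congr rfl fun a _ => ?_
      have h2 : ∑ a', jordanMatrix r μ a a' * w a' = ν * w a := congrFun hw a
      rw [smul_smul, ← h2, Finset.sum_smul]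
      refine Finset.sum_congr rfl fun a' _ => ?_
      rw [smul_smul, mul_comm]
    have hle : ‖ν‖ ≤ 1 := by
      have := norm_pow_le_pow_of_pos_eigenvector (a := 1) hy (by rw [hyA, one_smul])
        (hp (p + 1) (by omega)) (mem_spectrum_iff_exists_mulVec_eq.2 ⟨_, hz0, hzA⟩)
      exact le_of_pow_le_pow_left₀ (Nat.succ_ne_zero p) zero_le_one this
    refine lt_of_le_of_ne hle fun h1 => ?_
    -- A peripheral eigenvector in `K` would be a multiple of a `cyclicVec`, whose class sums are
    -- nonzero.
    obtain ⟨α, l, hα⟩ := exists_eq_smul_cyclicVec hA hn hr hh hc hp hN hx hxA hy hyA h1 hz0 hzA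
    have h2 : classSum c x (z : Fin n → ℂ) = 0 := LinearMap.mem_ker.1 z.2
    rw [hα, map_smul] at h2
    have h3 := congrFun h2 0
    have h5 : classSum c x (cyclicVec c y l) 0 =
        ZMod.stdAddChar (l * 0) * classDot c x y 0 :=
      classSum_class_mul x y (fun m => ZMod.stdAddChar (l * m)) 0
    rw [Pi.smul_apply, h5] at h3
    have hα0 : α = 0 := by
      rcases smul_eq_zero.1 h3 with h4 | h4
      · exact h4
      · exact absurd h4 (mul_ne_zero (stdAddChar_ne_zero _) (hdot 0))
    exact hz0 (by rw [hα, hα0, zero_smul])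
  have hinj : Function.Injective fun k : Fin h => ((k : ℕ) : ZMod h) := by
    intro k k' hkk
    have h1 := (ZMod.natCast_eq_natCast_iff' _ _ _).1 hkk
    rw [Nat.mod_eq_of_lt k.2, Nat.mod_eq_of_lt k'.2] at h1
    exact Fin.ext h1
  have hspan : ∀ z ∈ Submodule.span ℂ (Set.range fun k : Fin h => cyclicVec c y ((k : ℕ) : ZMod h)),
      ∃ g : ZMod h → ℂ, z = fun i => g (c i) * y i := by
    intro z hz
    induction hz using Submodule.span_induction with
    | mem z hz =>
      obtain ⟨k, rfl⟩ := hz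
      exact ⟨fun m => ZMod.stdAddChar (((k : ℕ) : ZMod h) * m), rfl⟩
    | zero => exact ⟨0, by ext i; simp⟩
    | add z w _ _ hz hw =>
      obtain ⟨g, rfl⟩ := hz
      obtain ⟨g', rfl⟩ := hw
      exact ⟨g + g', by ext i; simp [add_mul]⟩
    | smul a z _ hz =>
      obtain ⟨g, rfl⟩ := hz
      exact ⟨a • g, by ext i; simp [mul_assoc]⟩
  have hv : LinearIndependent ℂ (Sum.elim (fun k : Fin h => cyclicVec c y ((k : ℕ) : ZMod h))
      fun a => (b a : Fin n → ℂ)) := by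
    refine ((linearIndependent_cyclicVec hc hy hyA).comp _ hinj).sum_type
      (b.linearIndependent.map' K.subtype K.ker_subtype) ?_
    rw [Submodule.disjoint_def]
    intro z hz hzb
    obtain ⟨g, rfl⟩ := hspan z hz
    have hzK : (fun i => g (c i) * (y i : ℂ)) ∈ K := by
      refine (Submodule.span_le (p := K)).2 ?_ hzb
      rintro _ ⟨a, rfl⟩
      exact (b a).2
    have hg : g = 0 := by
      ext m
      have h1 := congrFun (LinearMap.mem_ker.1 hzK) m
      rw [classSum_class_mul] at h1
      exact (mul_eq_zero.1 h1).resolve_right (hdot m)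
    ext i
    simp [hg]
  have hcard : h + Fintype.card (Σ s : Fin t, Fin (r s)) = n := by
    apply le_antisymm
    · have := hv.fintype_card_le_finrank
      rwa [Fintype.card_sum, Fintype.card_fin, Module.finrank_fin_fun] at this
    · have h1 := LinearMap.finrank_range_add_finrank_ker (classSum c x)
      have h2 := Submodule.finrank_le (LinearMap.range (classSum c x))
      rw [Module.finrank_fintype_fun_eq_card, ZMod.card] at h2
      rw [Module.finrank_fin_fun, ← hK, Module.finrank_eq_card_basis b] at h1
      omega
  refine hasCyclicJordanForm_of_basis hr0 _ hv hcard (fun k => ?_) hbJ hρ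
  rw [Sum.elim_inl, hc.mulVec_cyclicVec hyA, stdAddChar_natCast]

end EvNonneg

/-- The rank condition `rank (A ^ 2) = rank A` holds in particular for every nonsingular `A`; it
is needed only for the implication from left to right. -/
theorem corollary3p6 {n h : ℕ} (A : Matrix (Fin n) (Fin n) ℝ)
    (hA : EvNonneg.IsIrreducible A) (hh : 1 < h) (hc : EvNonneg.HasCyclicIndex A h)
    (hρ : spectralRadius ℂ (EvNonneg.toComplex A) = 1) :
    ((A ^ 2).rank = A.rank →
      (EvNonneg.EventuallyNonneg A ↔
        EvNonneg.HasCyclicJordanForm A h ∧ EvNonneg.HasPositiveEigenvectors A)) ∧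
    (EvNonneg.HasCyclicJordanForm A h ∧ EvNonneg.HasPositiveEigenvectors A →
      EvNonneg.EventuallyNonneg A) := by
  have : NeZero h := ⟨by omega⟩
  obtain ⟨⟨-, c, hcc⟩, -⟩ := id hc
  have hn : 1 < n := by
    have := Fintype.card_le_of_surjective c hcc.1
    rw [ZMod.card, Fintype.card_fin] at this
    omega
  have : Nonempty (Fin n) := ⟨⟨0, by omega⟩⟩
  have hback : EvNonneg.HasCyclicJordanForm A h ∧ EvNonneg.HasPositiveEigenvectors A →
      EvNonneg.EventuallyNonneg A := fun hC =>
    EvNonneg.eventuallyNonneg_of_hasCyclicJordanForm hcc hC.1 hC.2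
  refine ⟨fun hr => ⟨?_, hback⟩, hback⟩
  rintro ⟨p, hp⟩
  obtain ⟨N, hN⟩ := hA.exists_sum_pow_pos hn hr hp
  have hpos := EvNonneg.EventuallyNonneg.hasPositiveEigenvectors hp hN hρ
  obtain ⟨⟨x, hx, hxA⟩, y, hy, hyA⟩ := id hpos
  exact ⟨EvNonneg.hasCyclicJordanForm_of_pow_nonneg hA hn hr hc hcc hp hN hx hxA hy hyA, hpos⟩
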